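/- Let $r,s,t,u$ be integers with $ru-st=\pm1$ and $rstu\ne 0$, and let $$G=\langle a_1,b_1,a_2\mid a_1b_1a_1^{-1}=b_1^{-1},\ a_2^2=a_1^{2r}b_1^s,\ a_2a_1^{2t}b_1^ua_2^{-1}=b_1^{-u}a_1^{-2t}\rangle$$ (the fundamental group of the torus semi-bundle $K(r,s,t,u)$). Write $\partial w/\partial a$ for the image in $\mathbb ZG$ of the Fox derivative of a word $w$ in the free group on $a_1,b_1,a_2$, and put $x=a_1^2$, $y=b_1$. Let $F_0=\mathbb ZG$, let $F_1$ be free over $\mathbb ZG$ on $\alpha_1,\beta_1,\alpha_2$, $F_2$ free on $\rho_1,\rho_2,\rho_3$, $F_3=\mathbb ZG$, $F_n=0$ for $n\ge4$, let $\varepsilon\colon F_0\to\mathbb Z$ be the augmentation, and let the $\mathbb ZG$-linear differentials be given by $d_1(\alpha_1)=a_1-1$, $d_1(\beta_1)=b_1-1$, $d_1(\alpha_2)=a_2-1$, \begin{align*} d_2(\rho_1)&=(1-b_1^{-1})\alpha_1+(a_1+b_1^{-1})\beta_1,\\ d_2(\rho_2)&=\frac{\partial a_1^{2r}}{\partial a_1}\alpha_1+a_1^{2r}\frac{\partial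 b_1^s}{\partial b_1}\beta_1+(-a_2-1)\alpha_2,\\ d_2(\rho_3)&=\Bigl(a_2\frac{\partial a_1^{2t}}{\partial a_1}+a_1^{-2t}b_1^{-u}\frac{\partial a_1^{2t}}{\partial a_1}\Bigr)\alpha_1+\Bigl(a_2a_1^{2t}\frac{\partial b_1^u}{\partial b_1}+b_1^{-u}\frac{\partial b_1^u}{\partial b_1}\Bigr)\beta_1+(1-a_1^{-2t}b_1^{-u})\alpha_2, \end{align*} and $d_3(1)=X_0\rho_1+Y_0\rho_2+Z_0\rho_3$ with $Y_0=1-x^ty^u$, $Z_0=a_2-x^ty^u$ and $$X_0=\Bigl(\sum_{k=t}^{r+t-1}a_1^{2k}\frac{\partial b_1^u}{\partial b_1}+\sum_{k=r+t}^{r-1}a_1^{2k}\frac{\partial b_1^s}{\partial b_1}+\sum_{k=t+1}^{r+t}a_1^{2k-1}\frac{\partial b_1^{-u}}{\partial b_1}+\sum_{k=r+t+1}^{r}a_1^{2k-1}\frac{\partial b_1^{-s}}{\partial b_1}\Bigr)b_1,$$ where $\sum_{k=m}^{n-1}=-\sum_{k=n}^{m-1}$ if $n<m$. Then: 1. Every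 $g\in G$ has a unique normal form $g=wx^iy^j$, where $i,j\in\mathbb Z$ and $w$ is a (possibly empty) word in the alphabet $\{a_1,a_2\}$ with alternating letters. Hence there is a well-defined homomorphism of abelian groups $s_0\colon F_0\to F_1$ with $s_0(g)=\frac{\partial g}{\partial a_1}\alpha_1+\frac{\partial g}{\partial b_1}\beta_1+\frac{\partial g}{\partial a_2}\alpha_2$, the Fox derivatives being those of the word $wa_1^{2i}b_1^j$. 2. $F$ is a free resolution of $\mathbb Z$ over $\mathbb ZG$, and there is a contracting homotopy of $F$ (maps of abelian groups $s_{-1}\colon\mathbb Z\to F_0$ and $s_n\colon F_n\to F_{n+1}$ with $\varepsilon s_{-1}=\mathrm{id}$, $d_1s_0+s_{-1}\varepsilon=\mathrm{id}$, $d_{n+1}s_n+s_{n-1}d_n=\mathrm{id}$ for $n\ge1$) with $s_{-1}(1)=1$ and with the above $s_0$. 3. Let $s$ be any such contracting homotopy. Let $F\otimes F$ be the tensor product over $\mathbb Z$ with the diagonal action of $G$ and the usual differential $\partial(x\otimes y)=dx\otimes y+(-1)^{\deg x}x\otimes dy$. For $x\in F_p$, $y\in F_q$ put $\tilde s(x\otimes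 y)=s_p(x)\otimes y+s_{-1}\varepsilon(x)\otimes s_q(y)$, where $s_{-1}\varepsilon$ is extended by zero to $F_p$, $p\ge1$. Define $\mathbb ZG$-linear maps $\Delta_n\colon F_n\to(F\otimes F)_n$ by $\Delta_0(1)=s_{-1}\varepsilon(1)\otimes s_{-1}\varepsilon(1)$ and $\Delta_n(\rho)=\tilde s_{n-1}\Delta_{n-1}d_n(\rho)$ for the basis elements $\rho$ of $F_n$, $n\ge1$. Then $\Delta$ is a diagonal approximation (an augmentation-preserving chain map of complexes of $\mathbb ZG$-modules), and $$\Delta_1(\alpha_1)=\alpha_1\otimes a_1+1\otimes\alpha_1,\quad \Delta_1(\beta_1)=\beta_1\otimes b_1+1\otimes\beta_1,\quad \Delta_1(\alpha_2)=\alpha_2\otimes a_2+1\otimes\alpha_2.$$ Moreover, for $X=\sum_g m_g\,g\in\mathbb ZG$ and $z\in F_1$ write $s_0(X)\mathbin{\hat\otimes}z=\sum_g m_g\,s_0(g)\otimes gz$. Then the component $\Delta_{1,1}\colon F_2\to F_1\otimes F_1$ of $\Delta_2$ satisfies \begin{align*} \Delta_{1,1}(\rho_1)&=b_1^{-1}\beta_1\otimes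 b_1^{-1}\alpha_1+\alpha_1\otimes a_1\beta_1-b_1^{-1}\beta_1\otimes b_1^{-1}\beta_1,\\ \Delta_{1,1}(\rho_2)&=s_0\Bigl(\frac{\partial a_1^{2r}}{\partial a_1}\Bigr)\mathbin{\hat\otimes}\alpha_1+s_0\Bigl(a_1^{2r}\frac{\partial b_1^s}{\partial b_1}\Bigr)\mathbin{\hat\otimes}\beta_1-\alpha_2\otimes a_2\alpha_2,\\ \Delta_{1,1}(\rho_3)&=s_0\Bigl(a_2\frac{\partial a_1^{2t}}{\partial a_1}+a_1^{-2t}b_1^{-u}\frac{\partial a_1^{2t}}{\partial a_1}\Bigr)\mathbin{\hat\otimes}\alpha_1+s_0\Bigl(a_2a_1^{2t}\frac{\partial b_1^u}{\partial b_1}+b_1^{-u}\frac{\partial b_1^u}{\partial b_1}\Bigr)\mathbin{\hat\otimes}\beta_1\\ &\quad-s_0(a_1^{-2t}b_1^{-u})\otimes a_1^{-2t}b_1^{-u}\alpha_2. \end{align*} -/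

import Mathlib

open scoped TensorProduct DirectSum

namespace Sapphire

/-! ### The group and its group ring -/

/-- The generators `a₁, b₁, a₂`. -/
inductive Gen : Type
  | a₁ : Gen
  | b₁ : Gen
  | a₂ : Gen

/-- The relators `r₁, r₂, r₃`, which also index the basis `ρ₁, ρ₂, ρ₃` of `F₂`. -/
inductive Rel : Type
  | ρ₁ : Rel
  | ρ₂ : Rel
  | ρ₃ : Rel

/-- The free group on `a₁, b₁, a₂`. -/
abbrev Free : Type := FreeGroup Gen

/-- The letters `a₁, b₁, a₂` in the free group. -/
abbrev wa₁ : Free := FreeGroup.of Gen.a₁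
abbrev wb₁ : Free := FreeGroup.of Gen.b₁
abbrev wa₂ : Free := FreeGroup.of Gen.a₂

/-- The relators: `a₁ b₁ a₁⁻¹ = b₁⁻¹`, `a₂² = a₁^{2r} b₁^s`,
`a₂ a₁^{2t} b₁^u a₂⁻¹ = b₁^{-u} a₁^{-2t}`, each written as (left side)(right side)⁻¹. -/
def relator (r s t u : ℤ) : Rel → Free
  | .ρ₁ => (wa₁ * wb₁ * wa₁⁻¹) * (wb₁⁻¹)⁻¹
  | .ρ₂ => (wa₁ ^ (2 * r) * wb₁ ^ s) * (wa₂ ^ 2)⁻¹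
  | .ρ₃ => (wa₂ * wa₁ ^ (2 * t) * wb₁ ^ u * wa₂⁻¹) * (wb₁ ^ (-u) * wa₁ ^ (-(2 * t)))⁻¹

/-- The fundamental group `G` of the torus semi-bundle `K(r,s,t,u)`. -/
abbrev G (r s t u : ℤ) : Type := PresentedGroup (Set.range (relator r s t u))

/-- The quotient map from the free group on `a₁, b₁, a₂` to `G`. -/
abbrev toG (r s t u : ℤ) : Free →* G r s t u :=
  PresentedGroup.mk (Set.range (relator r s t u))

/-- The integral group ring `ℤG`. -/
abbrev ZG (r s t u : ℤ) : Type := MonoidAlgebra ℤ (G r s t u)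

/-- A group element, as an element of the group ring. -/
noncomputable abbrev gr {r s t u : ℤ} (g : G r s t u) : ZG r s t u :=
  MonoidAlgebra.of ℤ (G r s t u) g

/-- A word in the generators, as an element of `ℤG`. -/
noncomputable abbrev wd (r s t u : ℤ) (w : Free) : ZG r s t u := gr (toG r s t u w)

/-! ### Fox derivatives -/

open Classical in
/-- Fox derivative with respect to `x` of a possibly unreduced word: the rules are
`∂(y w)/∂x = δ_{xy} + y ∂w/∂x` and `∂(y⁻¹ w)/∂x = -δ_{xy} y⁻¹ + y⁻¹ ∂w/∂x`. -/
noncomputable def foxList (x : Gen) : List (Gen × Bool) → MonoidAlgebra ℤ Free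
  | [] => 0
  | (y, true) :: L =>
      (if y = x then 1 else 0) + MonoidAlgebra.of ℤ Free (FreeGroup.of y) * foxList x L
  | (y, false) :: L =>
      -(if y = x then MonoidAlgebra.of ℤ Free (FreeGroup.of y)⁻¹ else 0)
        + MonoidAlgebra.of ℤ Free (FreeGroup.of y)⁻¹ * foxList x L

theorem foxList_append (x : Gen) (L M : List (Gen × Bool)) :
    foxList x (L ++ M) = foxList x L + MonoidAlgebra.of ℤ Free (FreeGroup.mk L) * foxList x M := by
  induction L with
  | nil =>
    have : FreeGroup.mk ([] : List (Gen × Bool)) = 1 := rfl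
    simp [foxList, this, ← MonoidAlgebra.one_def]
  | cons p L ih =>
    obtain ⟨y, b⟩ := p
    cases b
    · have h : FreeGroup.mk ((y, false) :: L) = (FreeGroup.of y)⁻¹ * FreeGroup.mk L := by
        simp [FreeGroup.of, FreeGroup.invRev]
      rw [h, map_mul, List.cons_append]
      simp only [foxList, ih, mul_add, mul_assoc, add_assoc]
    · have h : FreeGroup.mk ((y, true) :: L) = FreeGroup.of y * FreeGroup.mk L := by
        simp [FreeGroup.of]
      rw [h, map_mul, List.cons_append]
      simp only [foxList, ih, mul_add, mul_assoc, add_assoc]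

theorem foxList_step (x : Gen) (L M : List (Gen × Bool)) (h : FreeGroup.Red.Step L M) :
    foxList x L = foxList x M := by
  obtain @⟨L₁, L₂, y, b⟩ := h
  have key : foxList x ((y, b) :: (y, !b) :: L₂) = foxList x L₂ := by
    cases b <;> by_cases hy : y = x <;>
      simp [foxList, hy, mul_add, ← mul_assoc, MonoidAlgebra.single_mul_single,
        ← MonoidAlgebra.one_def]
  rw [foxList_append, foxList_append, key]

/-- The Fox derivative `∂w/∂x ∈ ℤ[Free]` of an element `w` of the free group. -/
noncomputable def foxFree (x : Gen) : Free → MonoidAlgebra ℤ Free :=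
  Quot.lift (foxList x) (foxList_step x)

theorem foxFree_mul (x : Gen) (v w : Free) :
    foxFree x (v * w) = foxFree x v + MonoidAlgebra.of ℤ Free v * foxFree x w := by
  induction v using Quot.ind with | _ L =>
  induction w using Quot.ind with | _ M =>
  exact foxList_append x L M

/-- The Fox derivative `∂w/∂x`, mapped to `ℤG`. -/
noncomputable def fox (r s t u : ℤ) (x : Gen) (w : Free) : ZG r s t u :=
  MonoidAlgebra.mapDomainRingHom ℤ (toG r s t u) (foxFree x w)

/-! ### The complex `F` -/

/-- The index set of the basis of `F_n`: `1`; `α₁, β₁, α₂`; `ρ₁, ρ₂, ρ₃`; `1`; nothing. -/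
abbrev B : ℕ → Type
  | 0 => Unit
  | 1 => Gen
  | 2 => Rel
  | 3 => Unit
  | _ + 4 => Empty

/-- The free `ℤG`-module `F_n` on `B n`. -/
def F (r s t u : ℤ) (n : ℕ) : Type := B n →₀ ZG r s t u

section Complex

variable (r s t u : ℤ)

noncomputable instance (n : ℕ) : AddCommGroup (F r s t u n) :=
  inferInstanceAs (AddCommGroup (B n →₀ ZG r s t u))

noncomputable instance (n : ℕ) : Module (ZG r s t u) (F r s t u n) :=
  inferInstanceAs (Module (ZG r s t u) (B n →₀ ZG r s t u))

/-- The basis elements. -/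
noncomputable def e (n : ℕ) (b : B n) : F r s t u n := Finsupp.single b 1

/-- The coefficient at a basis element. -/
noncomputable def coord (n : ℕ) (b : B n) : F r s t u n →ₗ[ZG r s t u] ZG r s t u :=
  Finsupp.lapply b

/-- The basis element `1` of `F₀ = ℤG`. -/
noncomputable abbrev e₀ : F r s t u 0 := e r s t u 0 ()
noncomputable abbrev α₁ : F r s t u 1 := e r s t u 1 Gen.a₁
noncomputable abbrev β₁ : F r s t u 1 := e r s t u 1 Gen.b₁
noncomputable abbrev α₂ : F r s t u 1 := e r s t u 1 Gen.a₂
noncomputable abbrev ρ₁ : F r s t u 2 := e r s t u 2 Rel.ρ₁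
noncomputable abbrev ρ₂ : F r s t u 2 := e r s t u 2 Rel.ρ₂
noncomputable abbrev ρ₃ : F r s t u 2 := e r s t u 2 Rel.ρ₃

/-- `d₁` on the basis: `α₁ ↦ a₁ - 1`, `β₁ ↦ b₁ - 1`, `α₂ ↦ a₂ - 1`. -/
noncomputable def d₁ (x : Gen) : F r s t u 0 :=
  (wd r s t u (FreeGroup.of x) - 1) • e₀ r s t u

/-- The coefficients of `d₂(ρ₁)`, `d₂(ρ₂)`, `d₂(ρ₃)` at `α₁`, `β₁`, `α₂`. -/
noncomputable def d₂coeff : Rel → Gen → ZG r s t u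
  | .ρ₁, .a₁ => 1 - wd r s t u wb₁⁻¹
  | .ρ₁, .b₁ => wd r s t u wa₁ + wd r s t u wb₁⁻¹
  | .ρ₁, .a₂ => 0
  | .ρ₂, .a₁ => fox r s t u .a₁ (wa₁ ^ (2 * r))
  | .ρ₂, .b₁ => wd r s t u (wa₁ ^ (2 * r)) * fox r s t u .b₁ (wb₁ ^ s)
  | .ρ₂, .a₂ => -wd r s t u wa₂ - 1
  | .ρ₃, .a₁ =>
      wd r s t u wa₂ * fox r s t u .a₁ (wa₁ ^ (2 * t))
        + wd r s t u (wa₁ ^ (-(2 * t)) * wb₁ ^ (-u)) * fox r s t u .a₁ (wa₁ ^ (2 * t))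
  | .ρ₃, .b₁ =>
      wd r s t u (wa₂ * wa₁ ^ (2 * t)) * fox r s t u .b₁ (wb₁ ^ u)
        + wd r s t u (wb₁ ^ (-u)) * fox r s t u .b₁ (wb₁ ^ u)
  | .ρ₃, .a₂ => 1 - wd r s t u (wa₁ ^ (-(2 * t)) * wb₁ ^ (-u))

/-- `d₂` on the basis. -/
noncomputable def d₂ (ρ : Rel) : F r s t u 1 :=
  d₂coeff r s t u ρ .a₁ • α₁ r s t u + d₂coeff r s t u ρ .b₁ • β₁ r s t u
    + d₂coeff r s t u ρ .a₂ • α₂ r s t u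

/-- The oriented sum `∑_{k=m}^{n-1} f k`, with the usual convention
`∑_{k=m}^{n-1} = -∑_{k=n}^{m-1}` when `n < m`. -/
noncomputable def osum (m n : ℤ) (f : ℤ → ZG r s t u) : ZG r s t u :=
  ∑ k ∈ Finset.Ico m n, f k - ∑ k ∈ Finset.Ico n m, f k

/-- `X₀`. For `r > 0`, `t < 0` all sums are ordinary sums, with upper limits
`r+t-1`, `r-1`, `r+t` and `r`; the oriented sums give the formula for all signs. -/
noncomputable def X₀ : ZG r s t u :=
  (osum r s t u t (r + t) (fun k => wd r s t u (wa₁ ^ (2 * k)) * fox r s t u .b₁ (wb₁ ^ u))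
    + osum r s t u (r + t) r (fun k => wd r s t u (wa₁ ^ (2 * k)) * fox r s t u .b₁ (wb₁ ^ s))
    + osum r s t u (t + 1) (r + t + 1)
        (fun k => wd r s t u (wa₁ ^ (2 * k - 1)) * fox r s t u .b₁ (wb₁ ^ (-u)))
    + osum r s t u (r + t + 1) (r + 1)
        (fun k => wd r s t u (wa₁ ^ (2 * k - 1)) * fox r s t u .b₁ (wb₁ ^ (-s))))
  * wd r s t u wb₁

/-- `Y₀ = 1 - x^t y^u`, where `x = a₁²` and `y = b₁`. -/
noncomputable def Y₀ : ZG r s t u := 1 - wd r s t u (wa₁ ^ (2 * t) * wb₁ ^ u)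

/-- `Z₀ = a₂ - x^t y^u`, where `x = a₁²` and `y = b₁`. -/
noncomputable def Z₀ : ZG r s t u := wd r s t u wa₂ - wd r s t u (wa₁ ^ (2 * t) * wb₁ ^ u)

/-- `d₃` on the basis: `1 ↦ X₀ ρ₁ + Y₀ ρ₂ + Z₀ ρ₃`. -/
noncomputable def d₃ : F r s t u 2 :=
  X₀ r s t u • ρ₁ r s t u + Y₀ r s t u • ρ₂ r s t u + Z₀ r s t u • ρ₃ r s t u

/-- The differential on the basis of `F_{n+1}`. -/
noncomputable def dBasis : (n : ℕ) → B (n + 1) → F r s t u n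
  | 0 => fun x => d₁ r s t u x
  | 1 => fun ρ => d₂ r s t u ρ
  | 2 => fun _ => d₃ r s t u
  | _ + 3 => fun b => Empty.elim b

/-- The differential `d_{n+1} : F_{n+1} → F_n`. -/
noncomputable def d (n : ℕ) : F r s t u (n + 1) →ₗ[ZG r s t u] F r s t u n :=
  Finsupp.linearCombination (ZG r s t u) (dBasis r s t u n)

/-- The augmentation `ε : F₀ = ℤG → ℤ`, `g ↦ 1`. -/
noncomputable def ε : F r s t u 0 →ₗ[ℤ] ℤ :=
  (MonoidAlgebra.lift ℤ ℤ (G r s t u) 1).toLinearMap ∘ₗ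
    (coord r s t u 0 ()).toAddMonoidHom.toIntLinearMap

/-- `⋯ → F₂ → F₁ → F₀ → ℤ → 0` is exact. Each `F_n` is a free `ℤG`-module by construction. -/
structure IsFreeResolution : Prop where
  exact_succ : ∀ n, Function.Exact (d r s t u (n + 1)) (d r s t u n)
  exact_zero : Function.Exact (d r s t u 0) (ε r s t u)
  surjective : Function.Surjective (ε r s t u)

/-! ### The complex `F ⊗ F` -/

/-- `(F ⊗ F)_n = ⨁_{p+q=n} F_p ⊗_ℤ F_q`. -/
abbrev FF (n : ℕ) : Type :=
  ⨁ p : {p : ℕ × ℕ // p.1 + p.2 = n}, F r s t u p.1.1 ⊗[ℤ] F r s t u p.1.2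

variable {r s t u}

/-- The inclusion `F_p ⊗ F_q → (F ⊗ F)_n`, for `p + q = n`. -/
noncomputable def incl {n : ℕ} (p q : ℕ) (h : p + q = n) :
    F r s t u p ⊗[ℤ] F r s t u q →ₗ[ℤ] FF r s t u n :=
  DirectSum.lof ℤ {p : ℕ × ℕ // p.1 + p.2 = n}
    (fun p => F r s t u p.1.1 ⊗[ℤ] F r s t u p.1.2) ⟨(p, q), h⟩

/-- The projection `π_{p,q} : (F ⊗ F)_n → F_p ⊗ F_q`, for `p + q = n`. -/
noncomputable def proj {n : ℕ} (p q : ℕ) (h : p + q = n) :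
    FF r s t u n →ₗ[ℤ] F r s t u p ⊗[ℤ] F r s t u q :=
  DirectSum.component ℤ {p : ℕ × ℕ // p.1 + p.2 = n}
    (fun p => F r s t u p.1.1 ⊗[ℤ] F r s t u p.1.2) ⟨(p, q), h⟩

variable (r s t u)

/-- The action of `G` on `F_n`. -/
noncomputable def act (n : ℕ) : Representation ℤ (G r s t u) (F r s t u n) :=
  Representation.ofModule' (F r s t u n)

/-- The diagonal action of `G` on `(F ⊗ F)_n`: `g (x ⊗ y) = g x ⊗ g y`. -/
noncomputable def actFF (n : ℕ) : Representation ℤ (G r s t u) (FF r s t u n) :=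
  Representation.directSum fun p : {p : ℕ × ℕ // p.1 + p.2 = n} =>
    (act r s t u p.1.1).tprod (act r s t u p.1.2)

/-- `x ⊗ y ↦ d x ⊗ y` on `F_p ⊗ F_q` (zero for `p = 0`). -/
noncomputable def dLeft (n : ℕ) : (p q : ℕ) → p + q = n + 1 →
    (F r s t u p ⊗[ℤ] F r s t u q →ₗ[ℤ] FF r s t u n)
  | 0, _, _ => 0
  | p + 1, q, h => incl p q (by omega) ∘ₗ
      TensorProduct.map (d r s t u p).toAddMonoidHom.toIntLinearMap LinearMap.id

/-- `x ⊗ y ↦ (-1)^p x ⊗ d y` on `F_p ⊗ F_q` (zero for `q = 0`). -/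
noncomputable def dRight (n : ℕ) : (p q : ℕ) → p + q = n + 1 →
    (F r s t u p ⊗[ℤ] F r s t u q →ₗ[ℤ] FF r s t u n)
  | _, 0, _ => 0
  | p, q + 1, h => (-1 : ℤ) ^ p • (incl p q (by omega) ∘ₗ
      TensorProduct.map LinearMap.id (d r s t u q).toAddMonoidHom.toIntLinearMap)

/-- The differential `∂_{n+1} : (F ⊗ F)_{n+1} → (F ⊗ F)_n`,
`∂(x ⊗ y) = d x ⊗ y + (-1)^p x ⊗ d y` for `x ∈ F_p`. -/
noncomputable def dFF (n : ℕ) : FF r s t u (n + 1) →ₗ[ℤ] FF r s t u n :=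
  DirectSum.toModule ℤ _ _ fun p =>
    dLeft r s t u n p.1.1 p.1.2 p.2 + dRight r s t u n p.1.1 p.1.2 p.2

/-- The augmentation `ε ⊗ ε : (F ⊗ F)_0 = F₀ ⊗ F₀ → ℤ ⊗ ℤ = ℤ`. -/
noncomputable def εFF : FF r s t u 0 →ₗ[ℤ] ℤ :=
  LinearMap.mul' ℤ ℤ ∘ₗ TensorProduct.map (ε r s t u) (ε r s t u) ∘ₗ proj 0 0 rfl

/-- A diagonal approximation: an augmentation-preserving chain map `F → F ⊗ F` of complexes
of `ℤG`-modules, where `G` acts diagonally on `F ⊗ F`. -/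
structure IsDiagonalApproximation
    (Δ : (n : ℕ) → F r s t u n →ₗ[ℤ] FF r s t u n) : Prop where
  equivariant : ∀ (n : ℕ) (g : G r s t u) (x : F r s t u n),
    Δ n (gr g • x) = actFF r s t u n g (Δ n x)
  chain_map : ∀ (n : ℕ) (x : F r s t u (n + 1)),
    dFF r s t u n (Δ (n + 1) x) = Δ n (d r s t u n x)
  augmentation : ∀ x : F r s t u 0, εFF r s t u (Δ 0 x) = ε r s t u x

/-! ### Normal forms and the map `s₀` -/

/-- The first normal form `w x^i y^j`, where `w` is a (possibly empty) word in the letters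
`a₁`, `a₂` with alternating letters, `x = a₁²` and `y = b₁`. -/
structure NormalForm : Type where
  w : List Gen
  letters : ∀ c ∈ w, c = Gen.a₁ ∨ c = Gen.a₂
  alternating : w.IsChain (· ≠ ·)
  i : ℤ
  j : ℤ

/-- The word `w a₁^{2i} b₁^j`. -/
def NormalForm.word (p : NormalForm) : Free :=
  (p.w.map FreeGroup.of).prod * (wa₁ ^ 2) ^ p.i * wb₁ ^ p.j

open Classical in
/-- The normal form word that represents `g`. (It exists and is unique when `ru - st = ±1`; the
value in the other case is irrelevant.) -/
noncomputable def normalWord (g : G r s t u) : Free :=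
  if h : ∃ p : NormalForm, toG r s t u p.word = g then h.choose.word else 1

/-- `∂w/∂a₁ α₁ + ∂w/∂b₁ β₁ + ∂w/∂a₂ α₂`. -/
noncomputable def foxVec (w : Free) : F r s t u 1 :=
  fox r s t u .a₁ w • α₁ r s t u + fox r s t u .b₁ w • β₁ r s t u
    + fox r s t u .a₂ w • α₂ r s t u

/-- The homomorphism of abelian groups `s₀ : ℤG → F₁`, where `s₀(g)` is computed by Fox
derivatives of the normal form word of `g`. -/
noncomputable def s₀ : ZG r s t u →ₗ[ℤ] F r s t u 1 :=
  Finsupp.linearCombination ℤ (fun g => foxVec r s t u (normalWord r s t u g)) ∘ₗ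
    (MonoidAlgebra.coeffLinearEquiv (M := G r s t u) (S := ℤ) ℤ).toLinearMap

/-! ### Contracting homotopies and Handel's construction -/

/-- A contracting homotopy of the augmented complex `⋯ → F₁ → F₀ → ℤ → 0`. -/
structure ContractingHomotopy where
  /-- `s_{-1} : ℤ → F₀` -/
  neg : ℤ →ₗ[ℤ] F r s t u 0
  /-- `s_n : F_n → F_{n+1}` -/
  map : (n : ℕ) → F r s t u n →ₗ[ℤ] F r s t u (n + 1)
  neg_eq : ∀ k, ε r s t u (neg k) = k
  zero_eq : ∀ x, d r s t u 0 (map 0 x) + neg (ε r s t u x) = x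
  succ_eq : ∀ n x, d r s t u (n + 1) (map (n + 1) x) + map n (d r s t u n x) = x

variable {r s t u}

/-- The contracting homotopy begins with `s_{-1}(1) = 1` and with the map `s₀` above. -/
def ContractingHomotopy.Extends (h : ContractingHomotopy r s t u) : Prop :=
  h.neg 1 = e₀ r s t u ∧ ∀ a : ZG r s t u, h.map 0 (a • e₀ r s t u) = s₀ r s t u a

/-- `(s_{-1} ε) ⊗ s_q` on `F_p ⊗ F_q`, where `s_{-1} ε` is extended by zero to `p ≥ 1`. -/
noncomputable def ContractingHomotopy.tildeRight (h : ContractingHomotopy r s t u) (n : ℕ) :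
    (p q : ℕ) → p + q = n → (F r s t u p ⊗[ℤ] F r s t u q →ₗ[ℤ] FF r s t u (n + 1))
  | 0, q, hn => incl 0 (q + 1) (by omega) ∘ₗ TensorProduct.map (h.neg ∘ₗ ε r s t u) (h.map q)
  | _ + 1, _, _ => 0

/-- The contracting homotopy `s̃_n` of `F ⊗ F`:
`s̃_n(x ⊗ y) = s_p(x) ⊗ y + s_{-1}ε(x) ⊗ s_q(y)` for `x ⊗ y ∈ F_p ⊗ F_q`. -/
noncomputable def ContractingHomotopy.tilde (h : ContractingHomotopy r s t u) (n : ℕ) :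
    FF r s t u n →ₗ[ℤ] FF r s t u (n + 1) :=
  DirectSum.toModule ℤ _ _ fun p =>
    incl (p.1.1 + 1) p.1.2 (by have := p.2; omega) ∘ₗ
        TensorProduct.map (h.map p.1.1) LinearMap.id
      + h.tildeRight n p.1.1 p.1.2 p.2

/-- The `ℤG`-linear extension of a map from the basis of `F_n` to `(F ⊗ F)_n`:
`∑ m_{g,b} g b ↦ ∑ m_{g,b} g (v b)`. -/
noncomputable def extend (n : ℕ) (v : B n → FF r s t u n) : F r s t u n →ₗ[ℤ] FF r s t u n :=
  (Finsupp.liftAddHom (M := ZG r s t u) fun b =>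
    ((LinearMap.applyₗ (v b)) ∘ₗ
      (actFF r s t u n).asAlgebraHom.toLinearMap).toAddMonoidHom).toIntLinearMap

/-- Handel's diagonal: `Δ₀ = s_{-1}ε ⊗ s_{-1}ε` and `Δ_n = s̃_{n-1} Δ_{n-1} d_n` on basis
elements, extended `ℤG`-linearly. -/
noncomputable def ContractingHomotopy.handel (h : ContractingHomotopy r s t u) :
    (n : ℕ) → F r s t u n →ₗ[ℤ] FF r s t u n
  | 0 => extend 0 fun b =>
      incl 0 0 rfl (h.neg (ε r s t u (e r s t u 0 b)) ⊗ₜ[ℤ] h.neg (ε r s t u (e r s t u 0 b)))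
  | n + 1 => extend (n + 1) fun b => h.tilde n (h.handel n (d r s t u n (e r s t u (n + 1) b)))

/-! ### The formulas -/

/-- `s₀(X) ⊗̂ y := ∑ m_g s₀(g) ⊗ g y` for `X = ∑ m_g g ∈ ℤG` and `y ∈ F₁`. -/
noncomputable def s₀tensor (X : ZG r s t u) (y : F r s t u 1) :
    F r s t u 1 ⊗[ℤ] F r s t u 1 :=
  X.coeff.sum fun g m => m • (s₀ r s t u (gr g) ⊗ₜ[ℤ] (gr g • y))

/-- The values of `Δ₁` on `α₁`, `β₁`, `α₂`. -/
structure DeltaOneFormulas (Δ₁ : F r s t u 1 →ₗ[ℤ] FF r s t u 1) : Prop where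
  on_α₁ : Δ₁ (α₁ r s t u) =
    incl 1 0 rfl (α₁ r s t u ⊗ₜ[ℤ] (wd r s t u wa₁ • e₀ r s t u))
      + incl 0 1 rfl (e₀ r s t u ⊗ₜ[ℤ] α₁ r s t u)
  on_β₁ : Δ₁ (β₁ r s t u) =
    incl 1 0 rfl (β₁ r s t u ⊗ₜ[ℤ] (wd r s t u wb₁ • e₀ r s t u))
      + incl 0 1 rfl (e₀ r s t u ⊗ₜ[ℤ] β₁ r s t u)
  on_α₂ : Δ₁ (α₂ r s t u) =
    incl 1 0 rfl (α₂ r s t u ⊗ₜ[ℤ] (wd r s t u wa₂ • e₀ r s t u))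
      + incl 0 1 rfl (e₀ r s t u ⊗ₜ[ℤ] α₂ r s t u)

/-- The values of `Δ_{1,1}` on `ρ₁`, `ρ₂`, `ρ₃`. -/
structure DeltaOneOneFormulas
    (Δ₁₁ : F r s t u 2 →ₗ[ℤ] F r s t u 1 ⊗[ℤ] F r s t u 1) : Prop where
  on_ρ₁ : Δ₁₁ (ρ₁ r s t u) =
    (wd r s t u wb₁⁻¹ • β₁ r s t u) ⊗ₜ[ℤ] (wd r s t u wb₁⁻¹ • α₁ r s t u)
      + α₁ r s t u ⊗ₜ[ℤ] (wd r s t u wa₁ • β₁ r s t u)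
      - (wd r s t u wb₁⁻¹ • β₁ r s t u) ⊗ₜ[ℤ] (wd r s t u wb₁⁻¹ • β₁ r s t u)
  on_ρ₂ : Δ₁₁ (ρ₂ r s t u) =
    s₀tensor (fox r s t u .a₁ (wa₁ ^ (2 * r))) (α₁ r s t u)
      + s₀tensor (wd r s t u (wa₁ ^ (2 * r)) * fox r s t u .b₁ (wb₁ ^ s)) (β₁ r s t u)
      - α₂ r s t u ⊗ₜ[ℤ] (wd r s t u wa₂ • α₂ r s t u)
  on_ρ₃ : Δ₁₁ (ρ₃ r s t u) =
    s₀tensor (wd r s t u wa₂ * fox r s t u .a₁ (wa₁ ^ (2 * t))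
        + wd r s t u (wa₁ ^ (-(2 * t)) * wb₁ ^ (-u)) * fox r s t u .a₁ (wa₁ ^ (2 * t)))
      (α₁ r s t u)
      + s₀tensor (wd r s t u (wa₂ * wa₁ ^ (2 * t)) * fox r s t u .b₁ (wb₁ ^ u)
          + wd r s t u (wb₁ ^ (-u)) * fox r s t u .b₁ (wb₁ ^ u))
        (β₁ r s t u)
      - s₀ r s t u (wd r s t u (wa₁ ^ (-(2 * t)) * wb₁ ^ (-u)))
          ⊗ₜ[ℤ] (wd r s t u (wa₁ ^ (-(2 * t)) * wb₁ ^ (-u)) • α₂ r s t u)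

end Complex

end Sapphire

/-!
The group `G` is the amalgamated product of the Klein bottle groups `⟨a₁, b₁⟩` and
`⟨a₂, x^t y^u⟩` over the lattice `⟨x, y⟩ ≅ ℤ²`, which has index two in both and is normal in `G`.

*Normal forms.* Conjugation by `a₁` and by `a₂` acts on the lattice by involutions, so right
multiplication by a letter either appends it to a normal form or cancels the last letter, up to its
square. This makes the set of normal forms a `G`-set (`stateHom`). The orbit of the empty word
recovers every normal form from the element that it represents, which gives uniqueness
(`val_injective`); every element is reached because multiplication by `g` is the action of `g`
(`val_stateHom`).

*Exactness.* In degree one exactness holds for every presentation: two words with the same image in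
`G` have Fox vectors that differ by a boundary (`foxVec_sub_mem_range`). In degree two the
`α₂`-coordinate of a cycle `A ρ₁ + B ρ₂ + C ρ₃` says `B (a₂ + 1) = C (1 - b₂⁻¹)`, where
`b₂ = x^t y^u` is inverted by `a₂`. Modulo the left ideal of `1 - b₂`, the group ring is the
permutation module on the cosets of `⟨b₂⟩`, where right multiplication by `a₂` has only infinite
orbits; hence `B = m (1 - b₂)` (`exists_eq_mul_one_sub`), and then `C = m (a₂ - b₂)`, so that
subtracting `d₃ m` leaves a multiple of `ρ₁`, which is zero because `1 - b₁⁻¹` is not a zero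
divisor. The identity `d₂ d₃ = 0` is a telescoping computation at `α₁` (`d₂d₃_a₁`) and a direct one
at `α₂`; at `β₁` it then follows from `d₁ d₂ = 0`.

*The homotopy and the diagonal.* The modules `F_n` are free over `ℤ`, so the start `s_{-1}`, `s₀`,
which is a homotopy by the fundamental formula of Fox calculus (`d_foxVec`), extends degree by
degree. For any extension, `s̃` contracts `F ⊗ F` (`dFF_tilde_succ`, `dFF_tilde_zero`), and the chain
map property of the diagonal follows by induction. In the component `F₁ ⊗ F₁` of `s̃ Δ₁(g x)` only
`s₀(g) ⊗ g x` survives, so `Δ_{1,1}(ρ)` depends only on the Fox derivatives in `d₂(ρ)`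
(`proj_handel_two`).
-/

namespace Sapphire

/-! ### The right action on normal forms -/

section NormalForms

/-- The letters `a₁` and `a₂`, indexed by `Bool` so that alternating words are lists of Booleans. -/
def letter : Bool → Gen
  | false => Gen.a₁
  | true => Gen.a₂

theorem letter_injective : Function.Injective letter := by
  intro a b h
  cases a <;> cases b <;> simp_all [letter]

/-- A reversed alternating word in `a₁`, `a₂` together with the exponents of `x` and `y`.
Reversal puts the last letter of the word at the head of the list, where right multiplication
by `a₁` and `a₂` acts. -/
abbrev State : Type := {l : List Bool // l.IsChain (· ≠ ·)} × (ℤ × ℤ)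

/-- The coordinate at `(t, u)` with respect to the basis `(r, s)`, `(t, u)` of `ℤ²`, provided that
the determinant `ru - st` is `±1`, and hence its own inverse. -/
def skew (r s t u : ℤ) (v : ℤ × ℤ) : ℤ := (r * u - s * t) * (r * v.2 - s * v.1)

/-- Conjugation by a letter on the lattice `⟨x, y⟩ = ℤ²`: `a₁` fixes `x` and inverts `y`, and
`a₂` fixes `x^r y^s` and inverts `x^t y^u`. -/
def conjLetter (r s t u : ℤ) : Bool → ℤ × ℤ → ℤ × ℤ
  | false, v => (v.1, -v.2)
  | true, v => (v.1 - 2 * skew r s t u v * t, v.2 - 2 * skew r s t u v * u)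

/-- The square of a letter: `a₁² = x` and `a₂² = x^r y^s`. -/
def sqLetter (r s : ℤ) : Bool → ℤ × ℤ
  | false => (1, 0)
  | true => (r, s)

variable {r s t u : ℤ}

theorem conjLetter_add (c : Bool) (v w : ℤ × ℤ) :
    conjLetter r s t u c (v + w) = conjLetter r s t u c v + conjLetter r s t u c w := by
  cases c <;> ext <;> simp [conjLetter, skew] <;> ring

theorem conjLetter_conjLetter (hdet : r * u - s * t = 1 ∨ r * u - s * t = -1) (c : Bool)
    (v : ℤ × ℤ) : conjLetter r s t u c (conjLetter r s t u c v) = v := by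
  have h : (r * u - s * t) ^ 2 = 1 := by rcases hdet with h | h <;> simp [h]
  cases c
  · simp [conjLetter]
  · ext
    · simp only [conjLetter, skew]
      linear_combination
        4 * t * (r * u - s * t) * (r * v.2 - s * v.1) * h
    · simp only [conjLetter, skew]
      linear_combination
        4 * u * (r * u - s * t) * (r * v.2 - s * v.1) * h

theorem conjLetter_sqLetter (c : Bool) :
    conjLetter r s t u c (sqLetter r s c) = sqLetter r s c := by
  have h : r * s - s * r = 0 := by ring
  cases c <;> simp [conjLetter, skew, sqLetter, h]

theorem conjLetter_zero (c : Bool) : conjLetter r s t u c 0 = 0 := by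
  cases c <;> simp [conjLetter, skew]

theorem conjLetter_neg (c : Bool) (v : ℤ × ℤ) :
    conjLetter r s t u c (-v) = -conjLetter r s t u c v := by
  cases c <;> ext <;> simp [conjLetter, skew] <;> ring

theorem conjLetter_true_self (hdet : r * u - s * t = 1 ∨ r * u - s * t = -1) :
    conjLetter r s t u true (t, u) = -(t, u) := by
  have h : (r * u - s * t) ^ 2 = 1 := by rcases hdet with h | h <;> simp [h]
  ext
  · simp only [conjLetter, skew, Prod.fst_neg]
    linear_combination (-2) * t * h
  · simp only [conjLetter, skew, Prod.snd_neg]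
    linear_combination (-2) * u * h

/-- Right multiplication by a letter `c` on states. The exponents are conjugated past `c`, which is
then appended to the word, or cancels the last letter of the word up to the square `c²`. -/
def mulLetter (r s t u : ℤ) (c : Bool) : State → State
  | (⟨[], _⟩, v) => (⟨[c], List.isChain_singleton c⟩, conjLetter r s t u c v)
  | (⟨b :: l, h⟩, v) =>
      if hc : c = b then (⟨l, h.of_cons⟩, conjLetter r s t u c v + sqLetter r s c)
      else (⟨c :: b :: l, List.isChain_cons_cons.2 ⟨hc, h⟩⟩, conjLetter r s t u c v)

/-- Right multiplication by `x^i y^j` on states: the exponents are translated by `(i, j)`. -/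
def shift (v : ℤ × ℤ) : Equiv.Perm State := (Equiv.refl _).prodCongr (Equiv.addRight v)

theorem shift_apply (v : ℤ × ℤ) (p : State) : shift v p = (p.1, p.2 + v) := rfl

theorem shift_mul (v w : ℤ × ℤ) : shift v * shift w = shift (v + w) := by
  ext1 p
  simp [shift_apply, Equiv.Perm.mul_apply, add_comm v w, add_assoc]

theorem shift_zero : shift 0 = 1 := by
  ext1 p
  simp [shift_apply]

theorem shift_inv (v : ℤ × ℤ) : (shift v)⁻¹ = shift (-v) := by
  rw [inv_eq_iff_mul_eq_one, shift_mul, add_neg_cancel, shift_zero]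

theorem shift_zpow (v : ℤ × ℤ) (n : ℤ) : shift v ^ n = shift (n • v) := by
  let φ : Multiplicative (ℤ × ℤ) →* Equiv.Perm State :=
    { toFun := fun v => shift v.toAdd, map_one' := shift_zero, map_mul' := fun v w =>
        (shift_mul _ _).symm }
  exact (map_zpow φ (Multiplicative.ofAdd v) n).symm

theorem mulLetter_mulLetter (hdet : r * u - s * t = 1 ∨ r * u - s * t = -1) (c : Bool)
    (p : State) :
    mulLetter r s t u c (mulLetter r s t u c p) = shift (sqLetter r s c) p := by
  obtain ⟨⟨l, hl⟩, v⟩ := p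
  rcases l with _ | ⟨b, l⟩
  · simp [mulLetter, shift_apply, conjLetter_conjLetter hdet]
  · by_cases hc : c = b
    · subst hc
      rcases l with _ | ⟨b', l⟩
      · simp [mulLetter, shift_apply, conjLetter_conjLetter hdet, conjLetter_add,
          conjLetter_sqLetter]
      · have : c ≠ b' := (List.isChain_cons_cons.1 hl).1
        simp [mulLetter, shift_apply, conjLetter_conjLetter hdet, conjLetter_add,
          conjLetter_sqLetter, this]
    · simp [mulLetter, hc, shift_apply, conjLetter_conjLetter hdet]

theorem mulLetter_shift (c : Bool) (v : ℤ × ℤ) (p : State) :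
    mulLetter r s t u c (shift v p) =
      shift (conjLetter r s t u c v) (mulLetter r s t u c p) := by
  obtain ⟨⟨l, hl⟩, w⟩ := p
  rcases l with _ | ⟨b, l⟩
  · simp [mulLetter, shift_apply, conjLetter_add]
  · by_cases hc : c = b
    · simp [mulLetter, hc, shift_apply, conjLetter_add, add_right_comm]
    · simp [mulLetter, hc, shift_apply, conjLetter_add]

/-- Right multiplication by a letter, as a permutation of the states. -/
def mulLetterPerm (hdet : r * u - s * t = 1 ∨ r * u - s * t = -1) (c : Bool) :
    Equiv.Perm State where
  toFun := mulLetter r s t u c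
  invFun p := mulLetter r s t u c (shift (-sqLetter r s c) p)
  left_inv p := by
    beta_reduce
    rw [mulLetter_shift, mulLetter_mulLetter hdet, ← Equiv.Perm.mul_apply, shift_mul,
      conjLetter_neg, conjLetter_sqLetter, neg_add_cancel, shift_zero, Equiv.Perm.one_apply]
  right_inv p := by
    beta_reduce
    rw [mulLetter_mulLetter hdet, ← Equiv.Perm.mul_apply, shift_mul, add_neg_cancel, shift_zero,
      Equiv.Perm.one_apply]

variable (hdet : r * u - s * t = 1 ∨ r * u - s * t = -1)

theorem mulLetterPerm_apply (c : Bool) (p : State) :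
    mulLetterPerm hdet c p = mulLetter r s t u c p := rfl

theorem mulLetterPerm_sq (c : Bool) :
    mulLetterPerm hdet c * mulLetterPerm hdet c = shift (sqLetter r s c) :=
  Equiv.ext (mulLetter_mulLetter hdet c)

theorem mulLetterPerm_shift (c : Bool) (v : ℤ × ℤ) :
    mulLetterPerm hdet c * shift v = shift (conjLetter r s t u c v) * mulLetterPerm hdet c :=
  Equiv.ext (mulLetter_shift c v)

/-- The inverses of the right multiplications by the generators. Right multiplication reverses the
order of products, so its inverse gives a left action. -/
def genPerm : Gen → Equiv.Perm State
  | .a₁ => (mulLetterPerm hdet false)⁻¹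
  | .b₁ => shift (-(0, 1))
  | .a₂ => (mulLetterPerm hdet true)⁻¹

theorem genPerm_a₁_zpow (n : ℤ) : genPerm hdet .a₁ ^ (2 * n) = shift (-(n, 0)) := by
  rw [genPerm, zpow_mul, inv_zpow, zpow_ofNat, sq, mulLetterPerm_sq, shift_inv, shift_zpow]
  simp [sqLetter]

theorem genPerm_b₁_zpow (n : ℤ) : genPerm hdet .b₁ ^ n = shift (-(0, n)) := by
  rw [genPerm, shift_zpow]
  simp

theorem lift_genPerm_relator (ρ : Rel) :
    FreeGroup.lift (genPerm hdet) (relator r s t u ρ) = 1 := by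
  cases ρ
  · simp only [relator, map_mul, map_inv, FreeGroup.lift_apply_of, mul_inv_eq_one]
    simp only [genPerm]
    rw [inv_inv, shift_inv, mul_assoc, inv_mul_eq_iff_eq_mul, mulLetterPerm_shift]
    simp [conjLetter]
  · simp only [relator, map_mul, map_inv, map_zpow, map_pow, FreeGroup.lift_apply_of,
      mul_inv_eq_one]
    rw [genPerm_a₁_zpow, genPerm_b₁_zpow, shift_mul, genPerm, inv_pow, sq, mulLetterPerm_sq,
      shift_inv]
    simp [sqLetter]
  · simp only [relator, map_mul, map_inv, map_zpow, FreeGroup.lift_apply_of, mul_inv_eq_one]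
    rw [← mul_neg, genPerm_a₁_zpow, genPerm_b₁_zpow, genPerm_a₁_zpow, genPerm_b₁_zpow, shift_mul,
      mul_assoc (genPerm hdet .a₂), shift_mul, genPerm, inv_inv, mul_assoc, inv_mul_eq_iff_eq_mul,
      mulLetterPerm_shift]
    have h₁ : -((t, 0) : ℤ × ℤ) + -(0, u) = -(t, u) := by simp
    have h₂ : -((0, -u) : ℤ × ℤ) + -(-t, 0) = (t, u) := by simp
    rw [h₁, h₂, conjLetter_true_self hdet]

/-- The action of `G` on the states, by `g ↦ (p ↦ p g⁻¹)`. -/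
def stateHom : G r s t u →* Equiv.Perm State :=
  PresentedGroup.toGroup (f := genPerm hdet) (by
    rintro _ ⟨ρ, rfl⟩
    exact lift_genPerm_relator hdet ρ)

theorem stateHom_of (x : Gen) :
    stateHom hdet (toG r s t u (FreeGroup.of x)) = genPerm hdet x :=
  PresentedGroup.toGroup.of _

end NormalForms

/-! ### Relations in `G` -/

section Relations

variable (r s t u : ℤ)

/-- The generators `a₁, b₁, a₂` of `G`. -/
abbrev gen (x : Gen) : G r s t u := toG r s t u (FreeGroup.of x)

theorem toG_relator (ρ : Rel) : toG r s t u (relator r s t u ρ) = 1 :=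
  PresentedGroup.one_of_mem (Set.mem_range_self ρ)

theorem gen_rel₁ : gen r s t u .a₁ * gen r s t u .b₁ * (gen r s t u .a₁)⁻¹ =
    (gen r s t u .b₁)⁻¹ := by
  have h := toG_relator r s t u .ρ₁
  simpa only [relator, map_mul, map_inv, mul_inv_eq_one] using h

theorem gen_rel₂ : gen r s t u .a₁ ^ (2 * r) * gen r s t u .b₁ ^ s = gen r s t u .a₂ ^ 2 := by
  have h := toG_relator r s t u .ρ₂
  simpa only [relator, map_mul, map_inv, map_zpow, map_pow, mul_inv_eq_one] using h

theorem gen_rel₃ :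
    gen r s t u .a₂ * gen r s t u .a₁ ^ (2 * t) * gen r s t u .b₁ ^ u * (gen r s t u .a₂)⁻¹ =
      gen r s t u .b₁ ^ (-u) * gen r s t u .a₁ ^ (-(2 * t)) := by
  have h := toG_relator r s t u .ρ₃
  simpa only [relator, map_mul, map_inv, map_zpow, mul_inv_eq_one] using h

theorem gen_a₁_mul_b₁ : gen r s t u .a₁ * gen r s t u .b₁ =
    (gen r s t u .b₁)⁻¹ * gen r s t u .a₁ :=
  mul_inv_eq_iff_eq_mul.1 (gen_rel₁ r s t u)

theorem gen_a₁_mul_b₁_zpow (n : ℤ) : gen r s t u .a₁ * gen r s t u .b₁ ^ n =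
    gen r s t u .b₁ ^ (-n) * gen r s t u .a₁ := by
  have h : SemiconjBy (gen r s t u .a₁) (gen r s t u .b₁) (gen r s t u .b₁)⁻¹ :=
    gen_a₁_mul_b₁ r s t u
  simpa only [SemiconjBy, inv_zpow'] using h.zpow_right n

theorem commute_sq_a₁_b₁ : Commute (gen r s t u .a₁ ^ (2 : ℤ)) (gen r s t u .b₁) := by
  have h := gen_a₁_mul_b₁_zpow r s t u (-1)
  rw [Commute, SemiconjBy, zpow_ofNat, sq, mul_assoc, gen_a₁_mul_b₁, ← mul_assoc]
  simp only [zpow_neg_one, neg_neg, zpow_one] at h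
  rw [h, mul_assoc]

/-- The element `x^i y^j` of the lattice `⟨x, y⟩ ⊆ G`. -/
def lat (v : ℤ × ℤ) : G r s t u := gen r s t u .a₁ ^ (2 * v.1) * gen r s t u .b₁ ^ v.2

theorem lat_add (v w : ℤ × ℤ) : lat r s t u (v + w) = lat r s t u v * lat r s t u w := by
  have h : Commute (gen r s t u .b₁ ^ v.2) (gen r s t u .a₁ ^ (2 * w.1)) := by
    rw [zpow_mul]
    exact ((commute_sq_a₁_b₁ r s t u).zpow_zpow _ _).symm
  simp only [lat, Prod.fst_add, Prod.snd_add, mul_add, zpow_add]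
  rw [mul_assoc, mul_assoc, ← mul_assoc (gen r s t u .b₁ ^ v.2), h.eq]
  simp only [mul_assoc]

theorem lat_zero : lat r s t u 0 = 1 := by simp [lat]

theorem lat_neg (v : ℤ × ℤ) : lat r s t u (-v) = (lat r s t u v)⁻¹ := by
  rw [eq_inv_iff_mul_eq_one, ← lat_add, neg_add_cancel, lat_zero]

theorem lat_zsmul (n : ℤ) (v : ℤ × ℤ) : lat r s t u (n • v) = lat r s t u v ^ n := by
  let φ : Multiplicative (ℤ × ℤ) →* G r s t u :=
    { toFun := fun v => lat r s t u v.toAdd, map_one' := lat_zero r s t u, map_mul' := fun v w =>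
        lat_add r s t u _ _ }
  exact map_zpow φ (Multiplicative.ofAdd v) n

theorem lat_comm (v w : ℤ × ℤ) :
    lat r s t u v * lat r s t u w = lat r s t u w * lat r s t u v := by
  rw [← lat_add, add_comm, lat_add]

theorem lat_fst (i : ℤ) : lat r s t u (i, 0) = gen r s t u .a₁ ^ (2 * i) := by simp [lat]

theorem lat_snd (j : ℤ) : lat r s t u (0, j) = gen r s t u .b₁ ^ j := by simp [lat]

theorem lat_rs : lat r s t u (r, s) = gen r s t u .a₂ ^ 2 := gen_rel₂ r s t u

/-- The element `x^t y^u` is inverted by `a₂`. -/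
theorem lat_tu_mul_a₂ : lat r s t u (t, u) * gen r s t u .a₂ =
    gen r s t u .a₂ * lat r s t u (-(t, u)) := by
  have h : gen r s t u .a₂ * lat r s t u (t, u) * (gen r s t u .a₂)⁻¹ =
      lat r s t u (-(t, u)) := by
    have h₁ : (-(t, u) : ℤ × ℤ) = (0, -u) + (-t, 0) := by simp
    rw [h₁, lat_add, lat_fst, lat_snd, mul_neg, ← gen_rel₃, lat]
    simp only [mul_assoc]
  have h' : SemiconjBy (gen r s t u .a₂) (lat r s t u (t, u)) (lat r s t u (t, u))⁻¹ := by
    rw [lat_neg] at h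
    exact mul_inv_eq_iff_eq_mul.1 h
  rw [lat_neg]
  simpa only [SemiconjBy, inv_inv] using h'.inv_right.symm

variable {r s t u} in
theorem lat_mul_letter (hdet : r * u - s * t = 1 ∨ r * u - s * t = -1) (c : Bool) (v : ℤ × ℤ) :
    lat r s t u v * gen r s t u (letter c) =
      gen r s t u (letter c) * lat r s t u (conjLetter r s t u c v) := by
  cases c
  · have h := gen_a₁_mul_b₁_zpow r s t u (-v.2)
    rw [neg_neg] at h
    simp only [letter, conjLetter, lat]
    rw [mul_assoc, ← h, ← mul_assoc, ← mul_assoc, ← zpow_add_one, ← zpow_one_add, add_comm]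
  · have h : (r * u - s * t) ^ 2 = 1 := by rcases hdet with h | h <;> simp [h]
    set q := skew r s t u v with hq
    set p := (r * u - s * t) * (v.1 * u - v.2 * t) with hp
    -- The determinant is its own inverse, so Cramer's rule gives integral coordinates of `v`.
    have hv : v = p • (r, s) + q • (t, u) := by
      ext
      · simp [hp, hq, skew]
        linear_combination (-v.1) * h
      · simp [hp, hq, skew]
        linear_combination (-v.2) * h
    have hw : conjLetter r s t u true v = p • (r, s) + q • (-(t, u)) := by
      have h₁ := congrArg Prod.fst hv
      have h₂ := congrArg Prod.snd hv
      simp only [Prod.smul_mk, smul_eq_mul, Prod.fst_add, Prod.snd_add] at h₁ h₂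
      ext
      · simp [conjLetter, ← hq]
        linear_combination h₁
      · simp [conjLetter, ← hq]
        linear_combination h₂
    have hB : SemiconjBy (gen r s t u .a₂) (lat r s t u (-(t, u))) (lat r s t u (t, u)) :=
      (lat_tu_mul_a₂ r s t u).symm
    have hA : SemiconjBy (gen r s t u .a₂) (lat r s t u (r, s)) (lat r s t u (r, s)) := by
      rw [lat_rs]
      exact (Commute.refl _).pow_right 2
    rw [hw, hv, lat_add, lat_add, lat_zsmul, lat_zsmul, lat_zsmul]
    exact ((hA.zpow_right p).mul_right (hB.zpow_right q)).symm

theorem lat_sqLetter (c : Bool) :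
    lat r s t u (sqLetter r s c) = gen r s t u (letter c) * gen r s t u (letter c) := by
  cases c
  · simp [sqLetter, lat_fst, letter, zpow_ofNat, sq]
  · rw [sqLetter, lat_rs, letter, sq]

end Relations

/-! ### Existence and uniqueness of normal forms -/

section NormalForms

variable (r s t u : ℤ)

/-- The class in `G` of the alternating word whose reversal is `l`. -/
def wordVal (l : List Bool) : G r s t u := (l.reverse.map fun c => gen r s t u (letter c)).prod

theorem wordVal_cons (c : Bool) (l : List Bool) :
    wordVal r s t u (c :: l) = wordVal r s t u l * gen r s t u (letter c) := by
  simp [wordVal]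

/-- The element of `G` that a state represents. -/
def State.val (p : State) : G r s t u := wordVal r s t u p.1.1 * lat r s t u p.2

variable {r s t u}

theorem val_shift (v : ℤ × ℤ) (p : State) :
    (shift v p).val r s t u = p.val r s t u * lat r s t u v := by
  simp [State.val, shift_apply, lat_add, mul_assoc]

variable (hdet : r * u - s * t = 1 ∨ r * u - s * t = -1)

theorem val_mulLetter (hdet : r * u - s * t = 1 ∨ r * u - s * t = -1) (c : Bool) (p : State) :
    (mulLetter r s t u c p).val r s t u = p.val r s t u * gen r s t u (letter c) := by
  obtain ⟨⟨l, hl⟩, v⟩ := p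
  simp only [State.val]
  rw [mul_assoc (wordVal r s t u l), lat_mul_letter hdet, ← mul_assoc]
  rcases l with _ | ⟨b, l⟩
  · simp [mulLetter, wordVal_cons]
  · by_cases hc : c = b
    · subst hc
      simp only [mulLetter, dif_pos, wordVal_cons]
      rw [add_comm, lat_add, lat_sqLetter]
      simp only [mul_assoc]
    · simp [mulLetter, hc, wordVal_cons]

theorem val_genPerm (x : Gen) (p : State) :
    (genPerm hdet x p).val r s t u = p.val r s t u * (gen r s t u x)⁻¹ := by
  have h (c : Bool) : ((mulLetterPerm hdet c)⁻¹ p).val r s t u =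
      p.val r s t u * (gen r s t u (letter c))⁻¹ := by
    rw [eq_mul_inv_iff_mul_eq, ← val_mulLetter hdet, ← mulLetterPerm_apply hdet,
      ← Equiv.Perm.mul_apply, mul_inv_cancel, Equiv.Perm.one_apply]
  cases x
  · exact h false
  · rw [genPerm, val_shift, lat_neg, lat_snd, zpow_one]
  · exact h true

theorem val_stateHom (g : G r s t u) (p : State) :
    (stateHom hdet g p).val r s t u = p.val r s t u * g⁻¹ := by
  obtain ⟨w, rfl⟩ := PresentedGroup.mk_surjective _ g
  induction w using FreeGroup.induction_on generalizing p with
  | C1 => simp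
  | of x => rw [stateHom_of, val_genPerm]
  | inv_of x ih =>
    rw [map_inv, map_inv, inv_inv, ← mul_inv_eq_iff_eq_mul, ← ih, ← Equiv.Perm.mul_apply,
      mul_inv_cancel, Equiv.Perm.one_apply]
  | mul v w hv hw => rw [map_mul, map_mul, Equiv.Perm.mul_apply, hv, hw, mul_inv_rev, mul_assoc]

/-- The state of the empty word. -/
def State.one : State := (⟨[], List.isChain_nil⟩, 0)

theorem val_surjective (hdet : r * u - s * t = 1 ∨ r * u - s * t = -1) :
    Function.Surjective (State.val r s t u) := fun g =>
  ⟨stateHom hdet g⁻¹ State.one, by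
    rw [val_stateHom, inv_inv]
    simp [State.one, State.val, wordVal, lat_zero]⟩

theorem stateHom_lat (v : ℤ × ℤ) : stateHom hdet (lat r s t u v) = shift (-v) := by
  rw [lat, map_mul, map_zpow, map_zpow, stateHom_of, stateHom_of, genPerm_a₁_zpow,
    genPerm_b₁_zpow, shift_mul]
  congr 1
  simp [Prod.ext_iff]

theorem stateHom_letter (c : Bool) :
    stateHom hdet (gen r s t u (letter c)) = (mulLetterPerm hdet c)⁻¹ := by
  cases c <;> exact stateHom_of hdet _

theorem stateHom_wordVal (l : List Bool) (hl : l.IsChain (· ≠ ·)) :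
    (stateHom hdet (wordVal r s t u l))⁻¹ State.one = (⟨l, hl⟩, 0) := by
  induction l with
  | nil => simp [wordVal, State.one]
  | cons c l ih =>
    rw [wordVal_cons, map_mul, mul_inv_rev, Equiv.Perm.mul_apply, ih hl.of_cons, stateHom_letter,
      inv_inv, mulLetterPerm_apply]
    rcases l with _ | ⟨b, l⟩
    · simp [mulLetter, conjLetter_zero]
    · have hc : c ≠ b := (List.isChain_cons_cons.1 hl).1
      simp [mulLetter, conjLetter_zero, hc]

theorem stateHom_val (p : State) : (stateHom hdet (p.val r s t u))⁻¹ State.one = p := by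
  rw [State.val, map_mul, mul_inv_rev, Equiv.Perm.mul_apply, stateHom_wordVal hdet p.1.1 p.1.2,
    stateHom_lat, shift_inv, neg_neg, shift_apply]
  simp

theorem val_injective (hdet : r * u - s * t = 1 ∨ r * u - s * t = -1) :
    Function.Injective (State.val r s t u) :=
  Function.LeftInverse.injective (g := fun g => (stateHom hdet g)⁻¹ State.one)
    (stateHom_val hdet)

/-- The lattice `⟨x, y⟩` is free abelian on `x` and `y`. -/
theorem lat_injective (hdet : r * u - s * t = 1 ∨ r * u - s * t = -1) :
    Function.Injective (lat r s t u) := fun v w h => by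
  have h' : State.val r s t u (⟨[], List.isChain_nil⟩, v) =
      State.val r s t u (⟨[], List.isChain_nil⟩, w) := by simpa [State.val] using h
  exact congrArg Prod.snd (val_injective hdet h')

/-- The normal form that a state encodes. -/
def State.normalForm (p : State) : NormalForm where
  w := p.1.1.reverse.map letter
  letters := by
    intro c hc
    obtain ⟨b, -, rfl⟩ := List.mem_map.1 hc
    cases b <;> simp [letter]
  alternating := by
    rw [List.isChain_map, List.isChain_reverse]
    exact p.1.2.imp fun _ _ h => fun h' => h (letter_injective h').symm
  i := p.2.1
  j := p.2.2

theorem toG_normalForm (p : State) :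
    toG r s t u p.normalForm.word = p.val r s t u := by
  simp only [NormalForm.word, State.normalForm, State.val, wordVal, lat, map_mul, map_zpow,
    map_list_prod, List.map_map, mul_assoc, map_pow, zpow_mul, zpow_ofNat]
  rfl

theorem normalForm_surjective : Function.Surjective State.normalForm := by
  rintro ⟨w, hw, hc, i, j⟩
  obtain ⟨l, rfl⟩ : ∃ l : List Bool, l.map letter = w := by
    clear hc
    induction w with
    | nil => exact ⟨[], rfl⟩
    | cons c w ih =>
      obtain ⟨l, rfl⟩ := ih fun c hc => hw c (List.mem_cons_of_mem _ hc)
      rcases hw c List.mem_cons_self with rfl | rfl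
      · exact ⟨false :: l, rfl⟩
      · exact ⟨true :: l, rfl⟩
  rw [List.isChain_map] at hc
  have hl : l.reverse.IsChain (· ≠ ·) :=
    List.isChain_reverse.2 (hc.imp fun _ _ h h' => h (congrArg letter h'.symm))
  exact ⟨(⟨l.reverse, hl⟩, (i, j)), by simp [State.normalForm]⟩

theorem existsUnique_normalForm (hdet : r * u - s * t = 1 ∨ r * u - s * t = -1)
    (g : G r s t u) : ∃! p : NormalForm, toG r s t u p.word = g := by
  obtain ⟨p, rfl⟩ := val_surjective hdet g
  refine ⟨p.normalForm, toG_normalForm p, fun q hq => ?_⟩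
  obtain ⟨q, rfl⟩ := normalForm_surjective q
  rw [toG_normalForm] at hq
  rw [val_injective hdet hq]

theorem toG_normalWord (hdet : r * u - s * t = 1 ∨ r * u - s * t = -1) (g : G r s t u) :
    toG r s t u (normalWord r s t u g) = g := by
  have h := (existsUnique_normalForm hdet g).exists
  rw [normalWord, dif_pos h]
  exact h.choose_spec

theorem normalWord_toG (hdet : r * u - s * t = 1 ∨ r * u - s * t = -1) (p : NormalForm) :
    normalWord r s t u (toG r s t u p.word) = p.word := by
  have h := (existsUnique_normalForm hdet (toG r s t u p.word)).exists
  rw [normalWord, dif_pos h]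
  exact congrArg _ ((existsUnique_normalForm hdet _).unique h.choose_spec rfl)

end NormalForms

/-! ### Fox calculus and exactness in degrees `0` and `1` -/

section FoxCalculus

variable (r s t u : ℤ)

theorem wd_one : wd r s t u 1 = 1 := by simp [wd, gr, ← MonoidAlgebra.one_def]

theorem wd_mul (v w : Free) : wd r s t u (v * w) = wd r s t u v * wd r s t u w := by
  simp only [wd, gr, map_mul]

theorem wd_inv_mul (w : Free) : wd r s t u w⁻¹ * wd r s t u w = 1 := by
  rw [← wd_mul, inv_mul_cancel, wd_one]

theorem fox_mul (x : Gen) (v w : Free) :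
    fox r s t u x (v * w) = fox r s t u x v + wd r s t u v * fox r s t u x w := by
  rw [fox, foxFree_mul, map_add, map_mul]
  simp [fox, wd, gr]

theorem fox_one (x : Gen) : fox r s t u x 1 = 0 := by
  have h := fox_mul r s t u x 1 1
  rwa [mul_one, wd_one, one_mul, left_eq_add] at h

theorem fox_inv (x : Gen) (w : Free) :
    fox r s t u x w⁻¹ = -(wd r s t u w⁻¹ * fox r s t u x w) := by
  have h := fox_mul r s t u x w⁻¹ w
  rw [inv_mul_cancel, fox_one] at h
  exact eq_neg_of_add_eq_zero_left h.symm

open Classical in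
theorem fox_of (x y : Gen) : fox r s t u x (FreeGroup.of y) = if y = x then 1 else 0 := by
  have h : foxFree x (FreeGroup.of y) = if y = x then 1 else 0 := by
    change foxList x [(y, true)] = _
    simp [foxList]
  rw [fox, h]
  split_ifs <;> simp

theorem foxVec_mul (v w : Free) :
    foxVec r s t u (v * w) = foxVec r s t u v + wd r s t u v • foxVec r s t u w := by
  simp only [foxVec, fox_mul, add_smul, mul_smul, smul_add]
  abel

theorem foxVec_one : foxVec r s t u 1 = 0 := by simp [foxVec, fox_one]

theorem foxVec_of (x : Gen) : foxVec r s t u (FreeGroup.of x) = e r s t u 1 x := by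
  cases x <;> simp [foxVec, fox_of]

theorem foxVec_inv (w : Free) :
    foxVec r s t u w⁻¹ = -(wd r s t u w⁻¹ • foxVec r s t u w) := by
  have h := foxVec_mul r s t u w⁻¹ w
  rw [inv_mul_cancel, foxVec_one] at h
  exact eq_neg_of_add_eq_zero_left h.symm

theorem d_e (n : ℕ) (b : B (n + 1)) : d r s t u n (e r s t u (n + 1) b) = dBasis r s t u n b := by
  rw [d, e]
  erw [Finsupp.linearCombination_single]
  rw [one_smul]

/-- The fundamental formula of Fox calculus. -/
theorem d_foxVec (w : Free) :
    d r s t u 0 (foxVec r s t u w) = (wd r s t u w - 1) • e₀ r s t u := by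
  induction w using FreeGroup.induction_on with
  | C1 => rw [foxVec_one, wd_one, sub_self, map_zero, zero_smul]
  | of x => rw [foxVec_of, d_e]; rfl
  | inv_of x ih =>
    rw [foxVec_inv, map_neg, map_smul, ih, ← mul_smul, mul_sub, wd_inv_mul, mul_one, ← neg_smul,
      neg_sub]
  | mul v w hv hw =>
    rw [foxVec_mul, map_add, map_smul, hv, hw, ← mul_smul, ← add_smul, wd_mul]
    congr 1
    noncomm_ring

variable {r s t u} in
theorem coord_smul_e (n : ℕ) (b : B n) (a : ZG r s t u) :
    coord r s t u n b (a • e r s t u n b) = a := by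
  rw [map_smul]
  erw [Finsupp.single_eq_same]
  exact mul_one a

/-- `ε` sends a group ring element to the sum of its coefficients. -/
theorem ε_smul (a : ZG r s t u) :
    ε r s t u (a • e₀ r s t u) = MonoidAlgebra.lift ℤ ℤ (G r s t u) 1 a :=
  congrArg (MonoidAlgebra.lift ℤ ℤ (G r s t u) 1) (coord_smul_e 0 () a)

theorem eq_coord_smul (x : F r s t u 0) : coord r s t u 0 () x • e₀ r s t u = x := by
  refine Finsupp.ext fun b => ?_
  exact coord_smul_e 0 () (coord r s t u 0 () x)

variable {r s t u} in
theorem ZG_induction {P : ZG r s t u → Prop} (a : ZG r s t u) (h0 : P 0)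
    (hadd : ∀ a b, P a → P b → P (a + b)) (hneg : ∀ a, P a → P (-a)) (hof : ∀ g, P (gr g)) :
    P a := by
  have hsub (a b : ZG r s t u) (ha : P a) (hb : P b) : P (a - b) := by
    rw [sub_eq_add_neg]
    exact hadd _ _ ha (hneg _ hb)
  induction a using MonoidAlgebra.induction_linear with
  | zero => exact h0
  | add a b ha hb => exact hadd a b ha hb
  | single g m =>
    have h : MonoidAlgebra.single g m = m • (gr g : ZG r s t u) := by simp [gr]
    rw [h]
    induction m using Int.induction_on with
    | zero => simpa using h0
    | succ i hi => rw [add_smul, one_smul]; exact hadd _ _ (hi (by simp [gr])) (hof g)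
    | pred i hi => rw [sub_smul, one_smul]; exact hsub _ _ (hi (by simp [gr])) (hof g)

variable {r s t u} in
/-- `F_n` is generated as an abelian group by the translates of the basis elements. -/
theorem F_induction {n : ℕ} {P : F r s t u n → Prop} (x : F r s t u n) (h0 : P 0)
    (hadd : ∀ a b, P a → P b → P (a + b)) (hneg : ∀ a, P a → P (-a))
    (hof : ∀ (g : G r s t u) b, P (gr g • e r s t u n b)) : P x := by
  refine Finsupp.induction_linear (motive := P) x h0 hadd fun b a => ?_
  have h : (Finsupp.single b a : B n →₀ ZG r s t u) = a • Finsupp.single b 1 := by simp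
  rw [h]
  change P (a • e r s t u n b)
  induction a using ZG_induction with
  | h0 => simpa using h0
  | hadd a a' ha ha' =>
    rw [add_smul]
    exact hadd _ _ (ha (by simp)) (ha' (by simp))
  | hneg a ha =>
    rw [neg_smul]
    exact hneg _ (ha (by simp))
  | hof g => exact hof g b

theorem F_hom_ext {n : ℕ} {M : Type*} [AddCommGroup M] {f f' : F r s t u n →ₗ[ℤ] M}
    (h : ∀ (g : G r s t u) b, f (gr g • e r s t u n b) = f' (gr g • e r s t u n b)) : f = f' := by
  ext x
  induction x using F_induction with
  | h0 => simp
  | hadd a b ha hb => rw [map_add, map_add, ha, hb]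
  | hneg a ha => rw [map_neg, map_neg, ha]
  | hof g b => exact h g b

theorem s₀_gr (g : G r s t u) :
    s₀ r s t u (gr g) = foxVec r s t u (normalWord r s t u g) := by
  simp [s₀, gr]

/-- The map `s₀`, transported along the identification of `F₀` with `ℤG`. -/
noncomputable def S₀ : F r s t u 0 →ₗ[ℤ] F r s t u 1 :=
  s₀ r s t u ∘ₗ (coord r s t u 0 ()).toAddMonoidHom.toIntLinearMap

theorem S₀_smul (a : ZG r s t u) : S₀ r s t u (a • e₀ r s t u) = s₀ r s t u a :=
  congrArg (s₀ r s t u) (coord_smul_e 0 () a)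

theorem ε_gr_smul (g : G r s t u) : ε r s t u (gr g • e₀ r s t u) = 1 := by
  simp [ε_smul, gr]

/-- The map `s_{-1} : ℤ → F₀` with `s_{-1}(1) = 1`. -/
noncomputable def sNeg : ℤ →ₗ[ℤ] F r s t u 0 := LinearMap.toSpanSingleton ℤ _ (e₀ r s t u)

theorem sNeg_one : sNeg r s t u 1 = e₀ r s t u := by simp [sNeg]

theorem ε_sNeg (k : ℤ) : ε r s t u (sNeg r s t u k) = k := by
  have h := ε_gr_smul r s t u 1
  rw [gr, map_one, one_smul] at h
  simp [sNeg, h]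

variable {r s t u}

theorem d_S₀_add (hdet : r * u - s * t = 1 ∨ r * u - s * t = -1) (x : F r s t u 0) :
    d r s t u 0 (S₀ r s t u x) + sNeg r s t u (ε r s t u x) = x := by
  have h : (d r s t u 0).toAddMonoidHom.toIntLinearMap ∘ₗ S₀ r s t u +
      sNeg r s t u ∘ₗ ε r s t u = LinearMap.id := by
    refine F_hom_ext r s t u fun g b => ?_
    change d r s t u 0 (S₀ r s t u (gr g • e₀ r s t u)) +
      sNeg r s t u (ε r s t u (gr g • e₀ r s t u)) = gr g • e₀ r s t u
    rw [S₀_smul, s₀_gr, d_foxVec, wd, toG_normalWord hdet, ε_gr_smul, sNeg_one, sub_smul, one_smul,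
      sub_add_cancel]
  exact LinearMap.congr_fun h x

theorem ε_d (x : F r s t u 1) : ε r s t u (d r s t u 0 x) = 0 := by
  induction x using F_induction with
  | h0 => simp
  | hadd a b ha hb => rw [map_add, map_add, ha, hb, add_zero]
  | hneg a ha => rw [map_neg, map_neg, ha, neg_zero]
  | hof g b =>
    rw [map_smul, d_e]
    change ε r s t u (gr g • d₁ r s t u b) = 0
    rw [d₁, ← mul_smul, mul_sub, mul_one, wd, gr, gr, ← map_mul, sub_smul, map_sub, ε_gr_smul,
      ε_gr_smul, sub_self]

theorem exact_d_ε (hdet : r * u - s * t = 1 ∨ r * u - s * t = -1) :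
    Function.Exact (d r s t u 0) (ε r s t u) := by
  intro x
  constructor
  · intro hx
    refine ⟨S₀ r s t u x, ?_⟩
    have h := d_S₀_add hdet x
    rwa [hx, map_zero, add_zero] at h
  · rintro ⟨y, rfl⟩
    exact ε_d y

theorem wd_relator (ρ : Rel) : wd r s t u (relator r s t u ρ) = 1 := by
  rw [wd, toG_relator, gr, map_one]

theorem foxVec_mul_inv (v w : Free) (h : toG r s t u v = toG r s t u w) :
    foxVec r s t u (v * w⁻¹) = foxVec r s t u v - foxVec r s t u w := by
  have h' : wd r s t u v = wd r s t u w := by rw [wd, wd, h]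
  rw [foxVec_mul, foxVec_inv, h', smul_neg, ← mul_smul, ← wd_mul, mul_inv_cancel, wd_one, one_smul,
    sub_eq_add_neg]

theorem wd_lat (v : ℤ × ℤ) : wd r s t u (wa₁ ^ (2 * v.1) * wb₁ ^ v.2) = gr (lat r s t u v) := by
  simp only [wd, lat, map_mul, map_zpow]

theorem fox_zpow_of_ne {x y : Gen} (hxy : y ≠ x) (n : ℤ) :
    fox r s t u x (FreeGroup.of y ^ n) = 0 := by
  have h : fox r s t u x (FreeGroup.of y) = 0 := by rw [fox_of, if_neg hxy]
  induction n using Int.induction_on with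
  | zero => rw [zpow_zero, fox_one]
  | succ i hi => rw [zpow_add_one, fox_mul, hi, h, mul_zero, add_zero]
  | pred i hi => rw [zpow_sub_one, fox_mul, hi, fox_inv, h, mul_zero, neg_zero, mul_zero, add_zero]

theorem foxVec_a₁_zpow (n : ℤ) :
    foxVec r s t u (wa₁ ^ n) = fox r s t u .a₁ (wa₁ ^ n) • α₁ r s t u := by
  rw [foxVec, fox_zpow_of_ne (x := .b₁) (by simp), fox_zpow_of_ne (x := .a₂) (by simp), zero_smul,
    zero_smul, add_zero, add_zero]

theorem foxVec_b₁_zpow (n : ℤ) :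
    foxVec r s t u (wb₁ ^ n) = fox r s t u .b₁ (wb₁ ^ n) • β₁ r s t u := by
  rw [foxVec, fox_zpow_of_ne (x := .a₁) (by simp), fox_zpow_of_ne (x := .a₂) (by simp), zero_smul,
    zero_smul, zero_add, add_zero]

/-- The differential `d₂` records the Fox derivatives of the relators. -/
theorem foxVec_relator (ρ : Rel) : foxVec r s t u (relator r s t u ρ) = d₂ r s t u ρ := by
  have h := toG_relator r s t u ρ
  cases ρ
  · rw [relator, map_mul, map_inv, mul_inv_eq_one] at h
    have h' : wd r s t u (wa₁ * wb₁) * wd r s t u wa₁⁻¹ = wd r s t u wb₁⁻¹ := by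
      rw [← wd_mul, wd, h]
    rw [relator, foxVec_mul_inv _ _ h, d₂, foxVec_mul, foxVec_mul, foxVec_inv, foxVec_inv,
      smul_neg, ← mul_smul, h']
    simp only [foxVec_of, d₂coeff]
    rw [sub_smul, add_smul, one_smul, zero_smul]
    abel
  · rw [relator, map_mul, map_inv, mul_inv_eq_one] at h
    rw [relator, foxVec_mul_inv _ _ h, d₂, sq, foxVec_mul, foxVec_mul, foxVec_of, foxVec_a₁_zpow,
      foxVec_b₁_zpow, ← mul_smul]
    simp only [d₂coeff]
    rw [sub_smul, neg_smul, one_smul]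
    abel
  · rw [relator, map_mul, map_inv, mul_inv_eq_one] at h
    have h' : wd r s t u (wb₁ ^ (-u)) * wd r s t u (wa₁ ^ (-(2 * t))) =
        wd r s t u (wa₁ ^ (-(2 * t)) * wb₁ ^ (-u)) := by
      have hc := lat_comm r s t u (0, -u) (-t, 0)
      rw [lat_fst, lat_snd, mul_neg] at hc
      simp only [wd, gr, ← map_mul]
      simp only [map_mul, map_zpow, hc]
    have h'' : wd r s t u (wa₂ * wa₁ ^ (2 * t) * wb₁ ^ u) * wd r s t u wa₂⁻¹ =
        wd r s t u (wa₁ ^ (-(2 * t)) * wb₁ ^ (-u)) := by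
      rw [← wd_mul, ← h', ← wd_mul, wd, h]
    have ha : fox r s t u .a₁ (wa₁ ^ (-(2 * t))) =
        -(wd r s t u (wa₁ ^ (-(2 * t))) * fox r s t u .a₁ (wa₁ ^ (2 * t))) := by
      rw [zpow_neg, fox_inv]
    have hb : fox r s t u .b₁ (wb₁ ^ (-u)) =
        -(wd r s t u (wb₁ ^ (-u)) * fox r s t u .b₁ (wb₁ ^ u)) := by
      rw [zpow_neg, fox_inv]
    rw [relator, foxVec_mul_inv _ _ h, d₂, foxVec_mul r s t u _ wa₂⁻¹, foxVec_inv, smul_neg,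
      ← mul_smul, h'', foxVec_mul, foxVec_mul, foxVec_mul, foxVec_of, foxVec_a₁_zpow,
      foxVec_b₁_zpow, foxVec_a₁_zpow, foxVec_b₁_zpow, ha, hb, ← mul_smul, ← mul_smul, ← mul_smul,
      mul_neg, ← mul_assoc, h']
    simp only [d₂coeff]
    rw [add_smul, add_smul, sub_smul, one_smul, neg_smul, neg_smul]
    abel

/-- The relators generate the relation module. -/
theorem foxVec_mem_range_of_toG_eq_one (w : Free) (hw : toG r s t u w = 1) :
    foxVec r s t u w ∈ LinearMap.range (d r s t u 1) := by
  have hw' : w ∈ Subgroup.normalClosure (Set.range (relator r s t u)) :=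
    (QuotientGroup.eq_one_iff w).1 hw
  let N : Subgroup Free :=
    { carrier := {w | toG r s t u w = 1 ∧ foxVec r s t u w ∈ LinearMap.range (d r s t u 1)}
      one_mem' := ⟨map_one _, by simp [foxVec_one]⟩
      mul_mem' := by
        rintro x y hx hy
        refine ⟨by rw [map_mul, hx.1, hy.1, one_mul], ?_⟩
        rw [foxVec_mul]
        exact add_mem hx.2 (Submodule.smul_mem _ _ hy.2)
      inv_mem' := by
        rintro x hx
        refine ⟨by rw [map_inv, hx.1, inv_one], ?_⟩
        rw [foxVec_inv]
        exact neg_mem (Submodule.smul_mem _ _ hx.2) }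
  have hN : N.Normal := by
    refine ⟨fun x hx g => ?_⟩
    have h : toG r s t u (g * x) = toG r s t u g := by rw [map_mul, hx.1, mul_one]
    refine ⟨by rw [map_mul, h, map_inv, mul_inv_cancel], ?_⟩
    rw [foxVec_mul_inv _ _ h, foxVec_mul, add_sub_cancel_left]
    exact Submodule.smul_mem _ _ hx.2
  have hle : Subgroup.normalClosure (Set.range (relator r s t u)) ≤ N := by
    refine Subgroup.normalClosure_le_normal ?_
    rintro _ ⟨ρ, rfl⟩
    refine ⟨toG_relator r s t u ρ, e r s t u 2 ρ, ?_⟩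
    rw [d_e, foxVec_relator]
    rfl
  exact (hle hw').2

theorem foxVec_sub_mem_range (v w : Free) (h : toG r s t u v = toG r s t u w) :
    foxVec r s t u v - foxVec r s t u w ∈ LinearMap.range (d r s t u 1) := by
  rw [← foxVec_mul_inv v w h]
  exact foxVec_mem_range_of_toG_eq_one _ (by rw [map_mul, map_inv, h, mul_inv_cancel])

/-- On `g e_b`, for a generator `b` with basis element `e_b`, the difference is that of
the Fox vectors of two words for `g b`: the normal form of `g` followed by `b`, and the normal form
of the product. -/
theorem sub_S₀_d_mem_range (hdet : r * u - s * t = 1 ∨ r * u - s * t = -1) (x : F r s t u 1) :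
    x - S₀ r s t u (d r s t u 0 x) ∈ LinearMap.range (d r s t u 1) := by
  induction x using F_induction with
  | h0 => simp
  | hadd a b ha hb =>
    rw [map_add, map_add, add_sub_add_comm]
    exact add_mem ha hb
  | hneg a ha =>
    rw [map_neg, map_neg, neg_sub_neg, ← neg_sub]
    exact neg_mem ha
  | hof g b =>
    have h : gr g • e r s t u 1 b - S₀ r s t u (d r s t u 0 (gr g • e r s t u 1 b)) =
        foxVec r s t u (normalWord r s t u g * FreeGroup.of b) -
          foxVec r s t u (normalWord r s t u (g * gen r s t u b)) := by
      rw [map_smul, d_e]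
      change gr g • e r s t u 1 b - S₀ r s t u (gr g • d₁ r s t u b) = _
      rw [d₁, ← mul_smul, mul_sub, mul_one, wd, gr, gr, ← map_mul, S₀_smul, map_sub, s₀_gr, s₀_gr,
        foxVec_mul, foxVec_of, wd, toG_normalWord hdet]
      abel
    rw [h]
    exact foxVec_sub_mem_range _ _ (by rw [map_mul, toG_normalWord hdet, toG_normalWord hdet])

theorem d_d_zero (x : F r s t u 2) : d r s t u 0 (d r s t u 1 x) = 0 := by
  induction x using F_induction with
  | h0 => simp
  | hadd a b ha hb => rw [map_add, map_add, ha, hb, add_zero]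
  | hneg a ha => rw [map_neg, map_neg, ha, neg_zero]
  | hof g b =>
    rw [map_smul, map_smul, d_e]
    change gr g • d r s t u 0 (d₂ r s t u b) = 0
    rw [← foxVec_relator, d_foxVec, wd_relator, sub_self, zero_smul, smul_zero]

theorem exact_d_one (hdet : r * u - s * t = 1 ∨ r * u - s * t = -1) :
    Function.Exact (d r s t u 1) (d r s t u 0) := by
  intro x
  constructor
  · intro hx
    have h := sub_S₀_d_mem_range hdet x
    rwa [hx, map_zero, sub_zero] at h
  · rintro ⟨y, rfl⟩
    exact d_d_zero y

end FoxCalculus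

/-! ### Annihilators in integral group rings -/

section GroupRing

/-- A finitely supported function whose support is stable under a map with infinite orbits
vanishes. -/
theorem finsupp_eq_zero_of_orbits {X : Type*} (v : X →₀ ℤ) (f : X → X)
    (hf : ∀ q, Function.Injective fun n : ℕ => f^[n] q) (hv : ∀ q, v q ≠ 0 → v (f q) ≠ 0) :
    v = 0 := by
  by_contra h
  obtain ⟨q, hq⟩ := Finsupp.ne_iff.1 h
  have hn (n : ℕ) : v (f^[n] q) ≠ 0 := by
    induction n with
    | zero => exact hq
    | succ n ih =>
      rw [Function.iterate_succ_apply']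
      exact hv _ ih
  have hfin : (Set.range fun n : ℕ => f^[n] q).Finite :=
    v.support.finite_toSet.subset (by
      rintro _ ⟨n, rfl⟩
      exact Finsupp.mem_support_iff.2 (hn n))
  exact Set.infinite_range_of_injective (hf q) hfin

variable {Γ : Type*} [Group Γ]

/-- If `b` has infinite order, then `1 - b` is not a right zero divisor in `ℤΓ`. -/
theorem eq_zero_of_mul_one_sub {b : Γ} (hb : ∀ n : ℕ, b ^ n = 1 → n = 0) {A : MonoidAlgebra ℤ Γ}
    (h : A * (1 - MonoidAlgebra.of ℤ Γ b) = 0) : A = 0 := by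
  have hA : A = A * MonoidAlgebra.of ℤ Γ b := by
    rwa [mul_sub, mul_one, sub_eq_zero] at h
  refine MonoidAlgebra.ext (finsupp_eq_zero_of_orbits A.coeff (· * b) (fun q n m hnm => ?_)
    fun q hq => ?_)
  · simp only [mul_right_iterate, mul_right_inj] at hnm
    wlog hle : n ≤ m generalizing n m
    · exact (this m n hnm.symm (by omega)).symm
    · have := hb (m - n) (by rw [pow_sub _ hle, hnm, mul_inv_cancel])
      omega
  · rw [hA]
    simpa using hq

theorem of_zpow_sub_one_mem (b : Γ) (k : ℤ) :
    MonoidAlgebra.of ℤ Γ (b ^ k) - 1 ∈ Ideal.span {1 - MonoidAlgebra.of ℤ Γ b} := by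
  set I := Ideal.span {1 - MonoidAlgebra.of ℤ Γ b} with hI
  have hb : 1 - MonoidAlgebra.of ℤ Γ b ∈ I := Ideal.subset_span rfl
  induction k using Int.induction_on with
  | zero => rw [zpow_zero, map_one, sub_self]; exact I.zero_mem
  | succ i hi =>
    have h : MonoidAlgebra.of ℤ Γ (b ^ ((i : ℤ) + 1)) - 1 =
        MonoidAlgebra.of ℤ Γ b * (MonoidAlgebra.of ℤ Γ (b ^ (i : ℤ)) - 1) -
          (1 - MonoidAlgebra.of ℤ Γ b) := by
      rw [add_comm (i : ℤ) 1, zpow_add, zpow_one, map_mul]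
      noncomm_ring
    rw [h]
    exact sub_mem (I.mul_mem_left _ hi) hb
  | pred i hi =>
    have h : MonoidAlgebra.of ℤ Γ (b ^ (-(i : ℤ) - 1)) - 1 =
        MonoidAlgebra.of ℤ Γ b⁻¹ * (MonoidAlgebra.of ℤ Γ (b ^ (-(i : ℤ))) - 1) +
          MonoidAlgebra.of ℤ Γ b⁻¹ * (1 - MonoidAlgebra.of ℤ Γ b) := by
      rw [sub_eq_neg_add (-(i : ℤ)) 1, zpow_add, zpow_neg_one, map_mul, mul_sub, mul_sub, mul_one,
        ← map_mul _ b⁻¹ b, inv_mul_cancel, map_one]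
      abel
    rw [h]
    exact add_mem (I.mul_mem_left _ hi) (I.mul_mem_left _ hb)

/-- The pushforward of an element of `ℤΓ` to the cosets of `⟨b⟩`. -/
noncomputable def toCosets (b : Γ) : MonoidAlgebra ℤ Γ →+ (Γ ⧸ Subgroup.zpowers b →₀ ℤ) :=
  (Finsupp.mapDomain.addMonoidHom QuotientGroup.mk).comp
    MonoidAlgebra.coeffAddEquiv.toAddMonoidHom

theorem toCosets_single (b g : Γ) (m : ℤ) :
    toCosets b (MonoidAlgebra.single g m) = Finsupp.single (QuotientGroup.mk g) m := by
  simp [toCosets]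

/-- The elements whose coefficients sum to zero over each coset of `⟨b⟩` form the left ideal
generated by `1 - b`. -/
theorem mem_span_of_toCosets_eq_zero {b : Γ} {A : MonoidAlgebra ℤ Γ} (h : toCosets b A = 0) :
    A ∈ Ideal.span {1 - MonoidAlgebra.of ℤ Γ b} := by
  set I := Ideal.span {1 - MonoidAlgebra.of ℤ Γ b} with hI
  let σ : (Γ ⧸ Subgroup.zpowers b →₀ ℤ) →+ MonoidAlgebra ℤ Γ :=
    Finsupp.liftAddHom fun q => MonoidAlgebra.singleAddHom q.out
  have key : A - σ (toCosets b A) ∈ I := by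
    clear h
    induction A using MonoidAlgebra.induction_linear with
    | zero => simp
    | add A A' hA hA' =>
      rw [map_add, map_add, add_sub_add_comm]
      exact add_mem hA hA'
    | single g m =>
      have hg : (QuotientGroup.mk g : Γ ⧸ Subgroup.zpowers b).out⁻¹ * g ∈ Subgroup.zpowers b :=
        QuotientGroup.eq.1 (QuotientGroup.out_eq' _)
      obtain ⟨k, hk⟩ := Subgroup.mem_zpowers_iff.1 hg
      set q := (QuotientGroup.mk g : Γ ⧸ Subgroup.zpowers b).out with hq
      have h : MonoidAlgebra.single g m - σ (toCosets b (MonoidAlgebra.single g m)) =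
          MonoidAlgebra.single q m * (MonoidAlgebra.of ℤ Γ (b ^ k) - 1) := by
        rw [toCosets_single, mul_sub, mul_one, MonoidAlgebra.of_apply,
          MonoidAlgebra.single_mul_single, hk, mul_inv_cancel_left, mul_one]
        simp [σ, hq]
      rw [h]
      exact I.mul_mem_left _ (of_zpow_sub_one_mem b k)
  rwa [h, map_zero, sub_zero] at key

/-- If `a` inverts `b` and no proper power of `a` lies in `⟨b⟩`, then right multiplication by
`a + 1` is injective modulo the left ideal of `1 - b`: on the cosets of `⟨b⟩` right
multiplication by `a` has only infinite orbits. -/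
theorem exists_eq_mul_one_sub {a b : Γ} (hab : a⁻¹ * b * a = b⁻¹)
    (ha : ∀ n : ℕ, a ^ n ∈ Subgroup.zpowers b → n = 0) {B C : MonoidAlgebra ℤ Γ}
    (h : B * (MonoidAlgebra.of ℤ Γ a + 1) = C * (1 - MonoidAlgebra.of ℤ Γ b⁻¹)) :
    ∃ m, B = m * (1 - MonoidAlgebra.of ℤ Γ b) := by
  have hconj (k : ℤ) : a⁻¹ * b ^ k * a = b ^ (-k) := by
    have := conj_zpow (i := k) (a := a⁻¹) (b := b)
    rw [inv_inv, hab] at this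
    rw [← this, inv_zpow']
  have hmem (g : Γ) : a⁻¹ * g * a ∈ Subgroup.zpowers b ↔ g ∈ Subgroup.zpowers b := by
    constructor
    · rintro ⟨k, hk⟩
      refine ⟨-k, ?_⟩
      have := hconj (-k)
      beta_reduce at hk ⊢
      rw [neg_neg, hk] at this
      simpa using this
    · rintro ⟨k, rfl⟩
      exact ⟨-k, (hconj k).symm⟩
  have hrel (g g' : Γ) : (QuotientGroup.mk (g * a) : Γ ⧸ Subgroup.zpowers b) =
      QuotientGroup.mk (g' * a) ↔ (QuotientGroup.mk g : Γ ⧸ Subgroup.zpowers b) =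
        QuotientGroup.mk g' := by
    rw [QuotientGroup.eq, QuotientGroup.eq, ← hmem (g⁻¹ * g')]
    simp only [mul_inv_rev, mul_assoc]
  let f : Γ ⧸ Subgroup.zpowers b → Γ ⧸ Subgroup.zpowers b :=
    fun q => QuotientGroup.mk (q.out * a)
  have hf (g : Γ) : f (QuotientGroup.mk g) = QuotientGroup.mk (g * a) :=
    (hrel _ _).2 (QuotientGroup.out_eq' _)
  have hfinj : Function.Injective f := by
    intro p q hpq
    obtain ⟨g, rfl⟩ := QuotientGroup.mk_surjective p
    obtain ⟨g', rfl⟩ := QuotientGroup.mk_surjective q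
    rwa [hf, hf, hrel] at hpq
  have hiter (g : Γ) (n : ℕ) : f^[n] (QuotientGroup.mk g) = QuotientGroup.mk (g * a ^ n) := by
    induction n with
    | zero => simp
    | succ n ih => rw [Function.iterate_succ_apply', ih, hf, mul_assoc, pow_succ]
  have hBa (A : MonoidAlgebra ℤ Γ) : toCosets b (A * MonoidAlgebra.of ℤ Γ a) =
      Finsupp.mapDomain f (toCosets b A) := by
    induction A using MonoidAlgebra.induction_linear with
    | zero => simp
    | add A A' hA hA' => rw [add_mul, map_add, hA, hA', map_add, Finsupp.mapDomain_add]
    | single g m =>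
      rw [MonoidAlgebra.of_apply, MonoidAlgebra.single_mul_single, toCosets_single,
        toCosets_single, Finsupp.mapDomain_single, hf, mul_one]
  have hCb (A : MonoidAlgebra ℤ Γ) : toCosets b (A * MonoidAlgebra.of ℤ Γ b⁻¹) =
      toCosets b A := by
    induction A using MonoidAlgebra.induction_linear with
    | zero => simp
    | add A A' hA hA' => rw [add_mul, map_add, hA, hA', map_add]
    | single g m =>
      rw [MonoidAlgebra.of_apply, MonoidAlgebra.single_mul_single, toCosets_single,
        toCosets_single, mul_one]
      congr 1
      rw [QuotientGroup.eq]
      simp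
  have hv : Finsupp.mapDomain f (toCosets b B) = -toCosets b B := by
    have := congrArg (toCosets b) h
    rw [mul_add, mul_sub, mul_one, mul_one, map_add, map_sub, hCb, sub_self, hBa] at this
    exact eq_neg_of_add_eq_zero_left this
  have hzero : toCosets b B = 0 := by
    refine finsupp_eq_zero_of_orbits _ f (fun q n m hnm => ?_) fun q hq => ?_
    · obtain ⟨g, rfl⟩ := QuotientGroup.mk_surjective q
      simp only [hiter] at hnm
      wlog hle : n ≤ m generalizing n m
      · exact (this m n hnm.symm (by omega)).symm
      · have hm : a ^ (m - n) ∈ Subgroup.zpowers b := by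
          have := QuotientGroup.eq.1 hnm
          have hp : (g * a ^ n)⁻¹ * (g * a ^ m) = a ^ (m - n) := by
            obtain ⟨k, rfl⟩ := Nat.exists_eq_add_of_le hle
            rw [pow_add, Nat.add_sub_cancel_left]
            group
          rwa [hp] at this
        have := ha _ hm
        omega
    · have := DFunLike.congr_fun hv (f q)
      rw [Finsupp.mapDomain_apply hfinj] at this
      intro h0
      rw [Finsupp.neg_apply, h0, neg_zero] at this
      exact hq this
  obtain ⟨m, hm⟩ := Ideal.mem_span_singleton'.1 (mem_span_of_toCosets_eq_zero hzero)
  exact ⟨m, hm.symm⟩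

end GroupRing

/-! ### Exactness in degrees `2` and `3` -/

section Exactness

variable {r s t u : ℤ}

theorem osum_self (m : ℤ) (f : ℤ → ZG r s t u) : osum r s t u m m f = 0 := by simp [osum]

theorem osum_succ (m n : ℤ) (f : ℤ → ZG r s t u) :
    osum r s t u m (n + 1) f = osum r s t u m n f + f n := by
  rcases le_or_gt m n with h | h
  · rw [osum, osum, Finset.Ico_eq_empty (a := n + 1) (by omega),
      Finset.Ico_eq_empty (a := n) (by omega), ← Finset.insert_Ico_right_eq_Ico_add_one h,
      Finset.sum_insert (by simp)]
    simp [add_comm]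
  · rw [osum, osum, Finset.Ico_eq_empty (a := m) (by omega),
      Finset.Ico_eq_empty (a := m) (by omega), ← Finset.insert_Ico_add_one_left_eq_Ico h,
      Finset.sum_insert (by simp)]
    simp

/-- A telescoping oriented sum. -/
theorem osum_eq_sub {f φ : ℤ → ZG r s t u} (h : ∀ n, φ (n + 1) = φ n + f n) (m n : ℤ) :
    osum r s t u m n f = φ n - φ m := by
  have key (k : ℤ) : osum r s t u m (m + k) f = φ (m + k) - φ m := by
    induction k using Int.induction_on with
    | zero => rw [add_zero, osum_self, sub_self]
    | succ i hi => rw [← add_assoc, osum_succ, hi, h]; abel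
    | pred i hi =>
      have h₁ := osum_succ m (m + (-(i : ℤ) - 1)) f
      have h₂ := h (m + (-(i : ℤ) - 1))
      rw [show m + (-(i : ℤ) - 1) + 1 = m + -(i : ℤ) by ring] at h₁ h₂
      rw [hi, h₂] at h₁
      rw [eq_sub_of_add_eq h₁.symm]
      abel
  have := key (n - m)
  rwa [add_sub_cancel] at this

theorem osum_add (m n : ℤ) (f g : ℤ → ZG r s t u) :
    osum r s t u m n f + osum r s t u m n g = osum r s t u m n fun k => f k + g k := by
  simp only [osum, Finset.sum_add_distrib]
  abel

theorem osum_mul (m n : ℤ) (f : ℤ → ZG r s t u) (c : ZG r s t u) :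
    osum r s t u m n f * c = osum r s t u m n fun k => f k * c := by
  simp only [osum, sub_mul, Finset.sum_mul]

theorem mul_osum (m n : ℤ) (f : ℤ → ZG r s t u) (c : ZG r s t u) :
    c * osum r s t u m n f = osum r s t u m n fun k => c * f k := by
  simp only [osum, mul_sub, Finset.mul_sum]

theorem osum_shift (m n : ℤ) (f : ℤ → ZG r s t u) :
    osum r s t u (m + 1) (n + 1) f = osum r s t u m n fun k => f (k + 1) := by
  rw [osum_eq_sub (f := fun k => f (k + 1)) (φ := fun k => osum r s t u (m + 1) (k + 1) f)
    fun k => osum_succ _ _ f, osum_self, sub_zero]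

theorem gr_mul (g h : G r s t u) : (gr (g * h) : ZG r s t u) = gr g * gr h := map_mul _ g h

theorem fox_b₁_zpow_mul (n : ℤ) :
    fox r s t u .b₁ (wb₁ ^ n) * (wd r s t u wb₁ - 1) = gr (lat r s t u (0, n)) - 1 := by
  have h := d_foxVec r s t u (wb₁ ^ n)
  rw [foxVec_b₁_zpow, map_smul, d_e] at h
  change fox r s t u .b₁ (wb₁ ^ n) • d₁ r s t u .b₁ = _ at h
  rw [d₁, ← mul_smul] at h
  have h' := congrArg (coord r s t u 0 ()) h
  rw [coord_smul_e, coord_smul_e] at h'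
  rw [h', lat_snd, wd, map_zpow]

theorem fox_a₁_zpow_add (m n : ℤ) :
    fox r s t u .a₁ (wa₁ ^ (2 * (m + n))) = fox r s t u .a₁ (wa₁ ^ (2 * m)) +
      gr (lat r s t u (m, 0)) * fox r s t u .a₁ (wa₁ ^ (2 * n)) := by
  rw [mul_add, zpow_add, fox_mul, lat_fst, wd, map_zpow]

theorem fox_a₁_sq : fox r s t u .a₁ (wa₁ ^ (2 * 1 : ℤ)) = 1 + wd r s t u wa₁ := by
  rw [mul_one, zpow_ofNat, sq, fox_mul, fox_of, if_pos rfl, mul_one]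

/-- Two of the four sums in `X₀`, multiplied by `b₁ - 1`: as `a₁ y^{-n} = y^n a₁`, they combine to
`(y^n - 1) ∑ x^k (1 + a₁)`, and `x^k (1 + a₁)` is the increment of `∂a₁^{2k}/∂a₁`. -/
theorem osum_X₀_mul (m m' n : ℤ) :
    (osum r s t u m m' (fun k => wd r s t u (wa₁ ^ (2 * k)) * fox r s t u .b₁ (wb₁ ^ n)) +
      osum r s t u (m + 1) (m' + 1)
        (fun k => wd r s t u (wa₁ ^ (2 * k - 1)) * fox r s t u .b₁ (wb₁ ^ (-n)))) *
        (wd r s t u wb₁ - 1) =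
      (gr (lat r s t u (0, n)) - 1) *
        (fox r s t u .a₁ (wa₁ ^ (2 * m')) - fox r s t u .a₁ (wa₁ ^ (2 * m))) := by
  rw [osum_shift, osum_add, osum_mul, ← osum_eq_sub (f := fun k => gr (lat r s t u (k, 0)) *
    (1 + wd r s t u wa₁)) (φ := fun k => fox r s t u .a₁ (wa₁ ^ (2 * k)))
    fun k => by rw [fox_a₁_zpow_add, fox_a₁_sq], mul_osum]
  congr 1
  funext k
  have h₁ : wd r s t u (wa₁ ^ (2 * k)) = gr (lat r s t u (k, 0)) := by
    rw [lat_fst, wd, map_zpow]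
  have h₂ : wd r s t u (wa₁ ^ (2 * (k + 1) - 1)) = gr (lat r s t u (k, 0)) * wd r s t u wa₁ := by
    rw [← h₁, ← wd_mul, ← zpow_add_one]
    congr 2
    ring
  have h₃ : (gr (lat r s t u (0, n)) : ZG r s t u) * gr (lat r s t u (k, 0)) =
      gr (lat r s t u (k, 0)) * gr (lat r s t u (0, n)) := by
    rw [← gr_mul, lat_comm, gr_mul]
  have h₄ : wd r s t u wa₁ * gr (lat r s t u (0, -n)) =
      gr (lat r s t u (0, n)) * wd r s t u wa₁ := by
    have := gen_a₁_mul_b₁_zpow r s t u (-n)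
    rw [neg_neg] at this
    rw [lat_snd, lat_snd, wd, ← gr_mul, ← gr_mul, this]
  rw [add_mul, mul_assoc, mul_assoc, fox_b₁_zpow_mul, fox_b₁_zpow_mul, h₁, h₂, sub_mul, one_mul,
    ← mul_assoc, h₃, mul_assoc, mul_sub _ _ (1 : ZG r s t u), mul_sub _ _ (1 : ZG r s t u),
    mul_assoc, h₄, mul_one, mul_one]
  noncomm_ring

/-- The element `x^t y^u`, which together with `a₂` generates the second Klein bottle group. -/
abbrev b₂ (r s t u : ℤ) : G r s t u := lat r s t u (t, u)

theorem gr_b₂_mul_a₂ : gr (b₂ r s t u) * wd r s t u wa₂ = wd r s t u wa₂ * gr (b₂ r s t u)⁻¹ := by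
  rw [wd, ← gr_mul, ← gr_mul, lat_tu_mul_a₂, lat_neg]

theorem gr_b₂_mul_inv : (gr (b₂ r s t u) : ZG r s t u) * gr (b₂ r s t u)⁻¹ = 1 := by
  rw [← gr_mul, mul_inv_cancel, gr, map_one]

theorem wd_x_y (i j : ℤ) : wd r s t u (wa₁ ^ (2 * i) * wb₁ ^ j) = gr (lat r s t u (i, j)) :=
  wd_lat (i, j)

theorem wd_b₂_inv : wd r s t u (wa₁ ^ (-(2 * t)) * wb₁ ^ (-u)) = gr (b₂ r s t u)⁻¹ := by
  rw [← mul_neg, wd_x_y, ← lat_neg]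
  rfl

theorem Y₀_eq : Y₀ r s t u = 1 - gr (b₂ r s t u) := by rw [Y₀, wd_x_y]

theorem Z₀_eq : Z₀ r s t u = wd r s t u wa₂ - gr (b₂ r s t u) := by rw [Z₀, wd_x_y]

/-- The coefficient of `d₂ d₃` at `α₁` vanishes. With `E n = ∂a₁^{2n}/∂a₁` it is
`(E r + x^r E t) - (E t + x^t E r)`, and both brackets are `E (r + t)`. -/
theorem d₂d₃_a₁ : X₀ r s t u * d₂coeff r s t u .ρ₁ .a₁ + Y₀ r s t u * d₂coeff r s t u .ρ₂ .a₁ +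
    Z₀ r s t u * d₂coeff r s t u .ρ₃ .a₁ = 0 := by
  have hX : X₀ r s t u * (1 - wd r s t u wb₁⁻¹) =
      (gr (lat r s t u (0, u)) - 1) * (gr (lat r s t u (t, 0)) *
        fox r s t u .a₁ (wa₁ ^ (2 * r))) -
      (gr (lat r s t u (0, s)) - 1) * (gr (lat r s t u (r, 0)) *
        fox r s t u .a₁ (wa₁ ^ (2 * t))) := by
    have h₁ := osum_X₀_mul (r := r) (s := s) (t := t) (u := u) t (r + t) u
    have h₂ := osum_X₀_mul (r := r) (s := s) (t := t) (u := u) (r + t) r s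
    have hb : wd r s t u wb₁ * (1 - wd r s t u wb₁⁻¹) = wd r s t u wb₁ - 1 := by
      rw [mul_sub, mul_one, ← wd_mul, mul_inv_cancel, wd_one]
    rw [add_comm r t, fox_a₁_zpow_add, add_comm t r, add_sub_cancel_left] at h₁
    rw [fox_a₁_zpow_add, sub_add_cancel_left] at h₂
    rw [X₀, mul_assoc, hb]
    rw [mul_neg] at h₂
    rw [← h₁, sub_eq_add_neg _ ((gr (lat r s t u (0, s)) - 1) * _), ← h₂, ← add_mul]
    congr 1
    abel
  have hE : fox r s t u .a₁ (wa₁ ^ (2 * r)) + gr (lat r s t u (r, 0)) *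
      fox r s t u .a₁ (wa₁ ^ (2 * t)) = fox r s t u .a₁ (wa₁ ^ (2 * t)) +
        gr (lat r s t u (t, 0)) * fox r s t u .a₁ (wa₁ ^ (2 * r)) := by
    rw [← fox_a₁_zpow_add, ← fox_a₁_zpow_add, add_comm]
  have hy (i j : ℤ) : (gr (lat r s t u (0, j)) : ZG r s t u) * gr (lat r s t u (i, 0)) =
      gr (lat r s t u (i, j)) := by
    rw [← gr_mul, ← lat_add]
    simp
  have ha : wd r s t u wa₂ * wd r s t u wa₂ = gr (lat r s t u (r, s)) := by
    rw [lat_rs, sq, gr_mul]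
  simp only [d₂coeff]
  rw [hX, Y₀_eq, Z₀_eq, wd_b₂_inv, ← add_mul]
  have hZ : (wd r s t u wa₂ - gr (b₂ r s t u)) * (wd r s t u wa₂ + gr (b₂ r s t u)⁻¹) =
      gr (lat r s t u (r, s)) - 1 := by
    rw [sub_mul, mul_add, mul_add, ha, gr_b₂_mul_a₂, gr_b₂_mul_inv]
    abel
  rw [← mul_assoc (wd r s t u wa₂ - gr (b₂ r s t u)), hZ, sub_mul, sub_mul, sub_mul, sub_mul,
    one_mul, one_mul, one_mul, one_mul, ← mul_assoc, ← mul_assoc, hy, hy]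
  rw [← sub_eq_zero] at hE
  rw [← hE]
  abel

/-- The coefficient of `d₂ d₃` at `α₂` vanishes. -/
theorem d₂d₃_a₂ : X₀ r s t u * d₂coeff r s t u .ρ₁ .a₂ + Y₀ r s t u * d₂coeff r s t u .ρ₂ .a₂ +
    Z₀ r s t u * d₂coeff r s t u .ρ₃ .a₂ = 0 := by
  simp only [d₂coeff]
  rw [wd_b₂_inv, Y₀_eq, Z₀_eq]
  have h₁ := gr_b₂_mul_a₂ (r := r) (s := s) (t := t) (u := u)
  have h₂ := gr_b₂_mul_inv (r := r) (s := s) (t := t) (u := u)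
  simp only [mul_zero, zero_add, sub_mul, mul_sub, one_mul, mul_one, mul_neg, h₁, h₂]
  abel

theorem exists_eq_F_two (x : F r s t u 2) :
    ∃ A B C : ZG r s t u, x = A • ρ₁ r s t u + B • ρ₂ r s t u + C • ρ₃ r s t u := by
  induction x using F_induction with
  | h0 => exact ⟨0, 0, 0, by simp⟩
  | hadd a b ha hb =>
    obtain ⟨A, B, C, rfl⟩ := ha
    obtain ⟨A', B', C', rfl⟩ := hb
    exact ⟨A + A', B + B', C + C', by rw [add_smul, add_smul, add_smul]; abel⟩
  | hneg a ha =>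
    obtain ⟨A, B, C, rfl⟩ := ha
    exact ⟨-A, -B, -C, by rw [neg_smul, neg_smul, neg_smul]; abel⟩
  | hof g b =>
    cases b
    · exact ⟨gr g, 0, 0, by rw [zero_smul, zero_smul, add_zero, add_zero]⟩
    · exact ⟨0, gr g, 0, by rw [zero_smul, zero_smul, zero_add, add_zero]⟩
    · exact ⟨0, 0, gr g, by rw [zero_smul, zero_smul, zero_add, zero_add]⟩

theorem exists_eq_F_three (x : F r s t u 3) :
    ∃ m : ZG r s t u, x = m • e r s t u 3 () := by
  induction x using F_induction with
  | h0 => exact ⟨0, by simp⟩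
  | hadd a b ha hb =>
    obtain ⟨A, rfl⟩ := ha
    obtain ⟨B, rfl⟩ := hb
    exact ⟨A + B, (add_smul _ _ _).symm⟩
  | hneg a ha =>
    obtain ⟨A, rfl⟩ := ha
    exact ⟨-A, (neg_smul _ _).symm⟩
  | hof g b => exact ⟨gr g, rfl⟩

theorem coord_smul_e_of_ne (n : ℕ) {b b' : B n} (h : b' ≠ b) (a : ZG r s t u) :
    coord r s t u n b (a • e r s t u n b') = 0 := by
  rw [map_smul]
  erw [Finsupp.single_eq_of_ne h.symm]
  exact mul_zero a

theorem d_one_combo (A B C : ZG r s t u) :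
    d r s t u 1 (A • ρ₁ r s t u + B • ρ₂ r s t u + C • ρ₃ r s t u) =
      (A * d₂coeff r s t u .ρ₁ .a₁ + B * d₂coeff r s t u .ρ₂ .a₁ +
        C * d₂coeff r s t u .ρ₃ .a₁) • α₁ r s t u +
      (A * d₂coeff r s t u .ρ₁ .b₁ + B * d₂coeff r s t u .ρ₂ .b₁ +
        C * d₂coeff r s t u .ρ₃ .b₁) • β₁ r s t u +
      (A * d₂coeff r s t u .ρ₁ .a₂ + B * d₂coeff r s t u .ρ₂ .a₂ +
        C * d₂coeff r s t u .ρ₃ .a₂) • α₂ r s t u := by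
  rw [map_add, map_add, map_smul, map_smul, map_smul, d_e, d_e, d_e]
  change A • d₂ r s t u .ρ₁ + B • d₂ r s t u .ρ₂ + C • d₂ r s t u .ρ₃ = _
  simp only [d₂, smul_add, add_smul, mul_smul]
  abel

theorem combo_eq_zero {A B C : ZG r s t u}
    (h : A • α₁ r s t u + B • β₁ r s t u + C • α₂ r s t u = 0) : A = 0 ∧ B = 0 ∧ C = 0 := by
  refine ⟨?_, ?_, ?_⟩
  · have := congrArg (coord r s t u 1 .a₁) h
    rwa [map_add, map_add, coord_smul_e, coord_smul_e_of_ne 1 (by simp),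
      coord_smul_e_of_ne 1 (by simp), map_zero, add_zero, add_zero] at this
  · have := congrArg (coord r s t u 1 .b₁) h
    rwa [map_add, map_add, coord_smul_e, coord_smul_e_of_ne 1 (by simp),
      coord_smul_e_of_ne 1 (by simp), map_zero, add_zero, zero_add] at this
  · have := congrArg (coord r s t u 1 .a₂) h
    rwa [map_add, map_add, coord_smul_e, coord_smul_e_of_ne 1 (by simp),
      coord_smul_e_of_ne 1 (by simp), map_zero, zero_add, zero_add] at this

theorem lat_pow_eq_one (hdet : r * u - s * t = 1 ∨ r * u - s * t = -1) {v : ℤ × ℤ} (hv : v ≠ 0)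
    (n : ℕ) (h : lat r s t u v ^ n = 1) : n = 0 := by
  rw [← zpow_natCast, ← lat_zsmul, ← lat_zero] at h
  have := smul_eq_zero.1 (lat_injective hdet h)
  simpa [hv] using this

theorem a₂_pow_mem (hdet : r * u - s * t = 1 ∨ r * u - s * t = -1) (n : ℕ)
    (h : gen r s t u .a₂ ^ n ∈ Subgroup.zpowers (b₂ r s t u)) : n = 0 := by
  obtain ⟨k, hk⟩ := Subgroup.mem_zpowers_iff.1 h
  have h₂ : lat r s t u ((n : ℤ) • (r, s)) = lat r s t u ((2 * k) • (t, u)) := by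
    rw [lat_zsmul, lat_zsmul, lat_rs, mul_comm, zpow_mul, hk, zpow_natCast, ← pow_mul, zpow_ofNat,
      ← pow_mul, mul_comm]
  have h₃ := lat_injective hdet h₂
  simp only [Prod.smul_mk, smul_eq_mul, Prod.mk.injEq] at h₃
  have h₄ : (n : ℤ) * (r * u - s * t) = 0 := by linear_combination u * h₃.1 - t * h₃.2
  have h₅ : r * u - s * t ≠ 0 := by omega
  simpa [h₅] using h₄

theorem d_two_smul (m : ZG r s t u) : d r s t u 2 (m • e r s t u 3 ()) =
    (m * X₀ r s t u) • ρ₁ r s t u + (m * Y₀ r s t u) • ρ₂ r s t u +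
      (m * Z₀ r s t u) • ρ₃ r s t u := by
  rw [map_smul, d_e]
  change m • d₃ r s t u = _
  simp only [d₃, smul_add, mul_smul]

theorem eq_zero_of_mul_one_sub_b₁ (hdet : r * u - s * t = 1 ∨ r * u - s * t = -1) {Q : ZG r s t u}
    (h : Q * (1 - wd r s t u wb₁) = 0) : Q = 0 := by
  refine eq_zero_of_mul_one_sub (fun n hn => ?_) h
  refine lat_pow_eq_one (v := (0, 1)) hdet (by simp) n ?_
  rwa [lat_snd, zpow_one]

theorem tu_ne_zero (hdet : r * u - s * t = 1 ∨ r * u - s * t = -1) : (t, u) ≠ 0 := by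
  intro h
  rw [Prod.mk_eq_zero] at h
  simp [h.1, h.2] at hdet

theorem d_d_zero_one (hdet : r * u - s * t = 1 ∨ r * u - s * t = -1) (x : F r s t u 3) :
    d r s t u 1 (d r s t u 2 x) = 0 := by
  obtain ⟨m, rfl⟩ := exists_eq_F_three x
  have h := d_one_combo (X₀ r s t u) (Y₀ r s t u) (Z₀ r s t u)
  rw [d₂d₃_a₁, d₂d₃_a₂, zero_smul, zero_smul, zero_add, add_zero] at h
  have h' := d_d_zero (X₀ r s t u • ρ₁ r s t u + Y₀ r s t u • ρ₂ r s t u + Z₀ r s t u • ρ₃ r s t u)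
  -- The coefficient at `β₁` is annihilated by `b₁ - 1` because `d₁ d₂ = 0`.
  rw [h, map_smul, d_e] at h'
  change _ • d₁ r s t u .b₁ = 0 at h'
  rw [d₁, ← mul_smul] at h'
  have h'' := congrArg (coord r s t u 0 ()) h'
  rw [coord_smul_e, map_zero, ← neg_sub, mul_neg, neg_eq_zero] at h''
  rw [eq_zero_of_mul_one_sub_b₁ hdet h'', zero_smul] at h
  rw [map_smul, d_e, map_smul]
  change m • d r s t u 1 (d₃ r s t u) = 0
  rw [d₃, h, smul_zero]

theorem exact_d_two (hdet : r * u - s * t = 1 ∨ r * u - s * t = -1) :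
    Function.Exact (d r s t u 2) (d r s t u 1) := by
  intro x
  constructor
  · intro hx
    obtain ⟨A, B, C, rfl⟩ := exists_eq_F_two x
    have ha₂ : B * (gr (gen r s t u .a₂) + 1) = C * (1 - gr (b₂ r s t u)⁻¹) := by
      rw [d_one_combo] at hx
      have h := (combo_eq_zero hx).2.2
      simp only [d₂coeff] at h
      rw [wd_b₂_inv, mul_zero, zero_add] at h
      rw [← sub_eq_zero, ← neg_eq_zero, ← h, wd]
      noncomm_ring
    have hab : (gen r s t u .a₂)⁻¹ * b₂ r s t u * gen r s t u .a₂ = (b₂ r s t u)⁻¹ := by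
      rw [mul_assoc, lat_tu_mul_a₂, inv_mul_cancel_left, lat_neg]
    -- The `α₂`-coordinate forces `(B, C) = m (Y₀, Z₀)`; after subtracting `d₃ m` only a multiple
    -- of `ρ₁` is left, and `1 - b₁⁻¹` is not a zero divisor.
    obtain ⟨m, hB⟩ := exists_eq_mul_one_sub hab (a₂_pow_mem hdet) ha₂
    have hC : C = m * Z₀ r s t u := by
      have h₁ := d₂d₃_a₂ (r := r) (s := s) (t := t) (u := u)
      simp only [d₂coeff] at h₁
      rw [wd_b₂_inv, mul_zero, zero_add, Y₀_eq] at h₁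
      have h₂ : (C - m * Z₀ r s t u) * (1 - gr (b₂ r s t u)⁻¹) = 0 := by
        have h₃ : Z₀ r s t u * (1 - gr (b₂ r s t u)⁻¹) =
            (1 - gr (b₂ r s t u)) * (wd r s t u wa₂ + 1) := by
          rw [eq_neg_of_add_eq_zero_right h₁]
          noncomm_ring
        rw [sub_mul, mul_assoc, h₃, ← ha₂, hB, mul_assoc, sub_self]
      refine sub_eq_zero.1 (eq_zero_of_mul_one_sub (fun n hn => ?_) h₂)
      rw [inv_pow, inv_eq_one] at hn
      exact lat_pow_eq_one hdet (tu_ne_zero hdet) n hn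
    refine ⟨m • e r s t u 3 (), ?_⟩
    have hdd := d_d_zero_one hdet (m • e r s t u 3 ())
    rw [d_two_smul] at hdd ⊢
    rw [← hC, Y₀_eq, ← hB] at hdd ⊢
    have hA : (m * X₀ r s t u - A) = 0 := by
      have h := d_one_combo (m * X₀ r s t u - A) 0 0
      have h' : (m * X₀ r s t u - A) • ρ₁ r s t u + (0 : ZG r s t u) • ρ₂ r s t u +
          (0 : ZG r s t u) • ρ₃ r s t u =
          ((m * X₀ r s t u) • ρ₁ r s t u + B • ρ₂ r s t u + C • ρ₃ r s t u) -
          (A • ρ₁ r s t u + B • ρ₂ r s t u + C • ρ₃ r s t u) := by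
        rw [sub_smul, zero_smul, zero_smul]
        abel
      rw [h', map_sub, hdd, hx, sub_zero] at h
      have h₁ := (combo_eq_zero h.symm).1
      simp only [d₂coeff, zero_mul, add_zero] at h₁
      refine eq_zero_of_mul_one_sub (fun n hn => ?_) h₁
      rw [map_inv, inv_pow, inv_eq_one] at hn
      refine lat_pow_eq_one (v := (0, 1)) hdet (by simp) n ?_
      rwa [lat_snd, zpow_one]
    rw [sub_eq_zero.1 hA]
  · rintro ⟨y, rfl⟩
    exact d_d_zero_one hdet y

theorem d_two_injective (hdet : r * u - s * t = 1 ∨ r * u - s * t = -1) :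
    Function.Injective (d r s t u 2) := by
  rw [injective_iff_map_eq_zero]
  intro x hx
  obtain ⟨m, rfl⟩ := exists_eq_F_three x
  rw [d_two_smul] at hx
  have h := congrArg (coord r s t u 2 .ρ₂) hx
  rw [map_add, map_add, coord_smul_e, coord_smul_e_of_ne 2 (by simp),
    coord_smul_e_of_ne 2 (by simp), map_zero, zero_add, add_zero, Y₀_eq] at h
  rw [eq_zero_of_mul_one_sub (lat_pow_eq_one hdet (tu_ne_zero hdet)) h, zero_smul]

instance (n : ℕ) : Subsingleton (F r s t u (n + 4)) :=
  inferInstanceAs (Subsingleton (Empty →₀ ZG r s t u))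

theorem isFreeResolution (hdet : r * u - s * t = 1 ∨ r * u - s * t = -1) :
    IsFreeResolution r s t u where
  exact_succ
    | 0 => exact_d_one hdet
    | 1 => exact_d_two hdet
    | 2 => fun x => by
      constructor
      · intro hx
        exact ⟨0, by rw [map_zero, d_two_injective hdet (hx.trans (map_zero _).symm)]⟩
      · rintro ⟨y, rfl⟩
        rw [Subsingleton.elim y 0, map_zero, map_zero]
    | n + 3 => fun x => by
      rw [Subsingleton.elim x 0]
      exact ⟨fun _ => ⟨0, map_zero _⟩, fun _ => map_zero _⟩
  exact_zero := exact_d_ε hdet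
  surjective k := ⟨sNeg r s t u k, ε_sNeg r s t u k⟩

end Exactness

/-! ### Contracting homotopies -/

section Homotopy

variable {r s t u : ℤ}

instance (n : ℕ) : Module.Free ℤ (F r s t u n) :=
  let φ : (B n →₀ (G r s t u →₀ ℤ)) ≃+ F r s t u n :=
    (Finsupp.mapRange.addEquiv MonoidAlgebra.coeffAddEquiv).symm
  Module.Free.of_equiv φ.toIntLinearEquiv

/-- `F_n` is free over `ℤ`, so an additive map from `F_n` lifts along `g` if its values lie in the
range of `g`. -/
theorem exists_lift {n : ℕ} {M N : Type*} [AddCommGroup M] [AddCommGroup N] (g : N →ₗ[ℤ] M)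
    (f : F r s t u n →ₗ[ℤ] M) (h : ∀ x, ∃ y, g y = f x) :
    ∃ l : F r s t u n →ₗ[ℤ] N, ∀ x, g (l x) = f x := by
  obtain ⟨l, hl⟩ := Module.projective_lifting_property g.rangeRestrict
    (f.codRestrict (LinearMap.range g) h) g.surjective_rangeRestrict
  exact ⟨l, fun x => congrArg Subtype.val (LinearMap.congr_fun hl x)⟩

theorem exists_contractingHomotopy (hdet : r * u - s * t = 1 ∨ r * u - s * t = -1) :
    ∃ h : ContractingHomotopy r s t u, h.Extends := by
  let D (n : ℕ) : F r s t u (n + 1) →ₗ[ℤ] F r s t u n :=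
    (d r s t u n).toAddMonoidHom.toIntLinearMap
  obtain ⟨s₁, hs₁⟩ := exists_lift (D 1) (LinearMap.id - S₀ r s t u ∘ₗ D 0)
    (sub_S₀_d_mem_range hdet)
  replace hs₁ : ∀ x, d r s t u 1 (s₁ x) = x - S₀ r s t u (d r s t u 0 x) := hs₁
  obtain ⟨s₂, hs₂⟩ := exists_lift (D 2) (LinearMap.id - s₁ ∘ₗ D 1) fun x => by
    refine (exact_d_two hdet _).1 ?_
    change d r s t u 1 (x - s₁ (d r s t u 1 x)) = 0
    rw [map_sub, hs₁, d_d_zero, map_zero, sub_zero, sub_self]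
  replace hs₂ : ∀ x, d r s t u 2 (s₂ x) = x - s₁ (d r s t u 1 x) := hs₂
  refine ⟨{ neg := sNeg r s t u
            map := fun
              | 0 => S₀ r s t u
              | 1 => s₁
              | 2 => s₂
              | _ + 3 => 0
            neg_eq := ε_sNeg r s t u
            zero_eq := d_S₀_add hdet
            succ_eq := ?_ }, sNeg_one r s t u, S₀_smul r s t u⟩
  rintro (_ | _ | _ | n) x
  · exact sub_eq_iff_eq_add.1 (hs₁ x).symm ▸ rfl
  · exact sub_eq_iff_eq_add.1 (hs₂ x).symm ▸ rfl
  · change d r s t u 3 0 + s₂ (d r s t u 2 x) = x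
    rw [map_zero, zero_add]
    apply d_two_injective hdet
    rw [hs₂, d_d_zero_one hdet, map_zero, sub_zero]
  · exact Subsingleton.elim _ _

end Homotopy

/-! ### The contracting homotopy of `F ⊗ F` -/

section TensorSquare

variable {r s t u : ℤ}

theorem FF_hom_ext {n : ℕ} {M : Type*} [AddCommGroup M] {f f' : FF r s t u n →ₗ[ℤ] M}
    (h : ∀ p q hpq x y, f (incl p q hpq (x ⊗ₜ[ℤ] y)) = f' (incl p q hpq (x ⊗ₜ[ℤ] y))) :
    f = f' := by
  refine DirectSum.linearMap_ext ℤ fun p => TensorProduct.ext' fun x y => ?_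
  exact h p.1.1 p.1.2 p.2 x y

theorem dFF_incl (n p q : ℕ) (h : p + q = n + 1) (z : F r s t u p ⊗[ℤ] F r s t u q) :
    dFF r s t u n (incl p q h z) = dLeft r s t u n p q h z + dRight r s t u n p q h z := by
  rw [dFF, incl, DirectSum.toModule_lof]
  rfl

theorem tilde_incl (h : ContractingHomotopy r s t u) (n p q : ℕ) (hpq : p + q = n)
    (x : F r s t u p) (y : F r s t u q) :
    h.tilde n (incl p q hpq (x ⊗ₜ[ℤ] y)) =
      incl (p + 1) q (by omega) (h.map p x ⊗ₜ[ℤ] y) + h.tildeRight n p q hpq (x ⊗ₜ[ℤ] y) := by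
  rw [ContractingHomotopy.tilde, incl, DirectSum.toModule_lof]
  rfl

theorem dLeft_succ (n p q : ℕ) (h : p + 1 + q = n + 1) (x : F r s t u (p + 1)) (y : F r s t u q) :
    dLeft r s t u n (p + 1) q h (x ⊗ₜ[ℤ] y) =
      incl p q (by omega) (d r s t u p x ⊗ₜ[ℤ] y) := rfl

theorem dLeft_zero (n q : ℕ) (h : 0 + q = n + 1) (z : F r s t u 0 ⊗[ℤ] F r s t u q) :
    dLeft r s t u n 0 q h z = 0 := rfl

theorem dRight_succ (n p q : ℕ) (h : p + (q + 1) = n + 1) (x : F r s t u p)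
    (y : F r s t u (q + 1)) :
    dRight r s t u n p (q + 1) h (x ⊗ₜ[ℤ] y) =
      (-1 : ℤ) ^ p • incl p q (by omega) (x ⊗ₜ[ℤ] d r s t u q y) := rfl

theorem dRight_zero (n p : ℕ) (h : p + 0 = n + 1) (z : F r s t u p ⊗[ℤ] F r s t u 0) :
    dRight r s t u n p 0 h z = 0 := by
  cases p <;> rfl

theorem tildeRight_zero (h : ContractingHomotopy r s t u) (n q : ℕ) (hq : 0 + q = n)
    (x : F r s t u 0) (y : F r s t u q) :
    h.tildeRight n 0 q hq (x ⊗ₜ[ℤ] y) =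
      incl 0 (q + 1) (by omega) (h.neg (ε r s t u x) ⊗ₜ[ℤ] h.map q y) := rfl

theorem tildeRight_succ (h : ContractingHomotopy r s t u) (n p q : ℕ) (hq : p + 1 + q = n)
    (z : F r s t u (p + 1) ⊗[ℤ] F r s t u q) :
    h.tildeRight n (p + 1) q hq z = 0 := rfl

theorem tildeRight_d (h : ContractingHomotopy r s t u) (n p q : ℕ) (hpq : p + q = n)
    (x : F r s t u (p + 1)) (y : F r s t u q) :
    h.tildeRight n p q hpq (d r s t u p x ⊗ₜ[ℤ] y) = 0 := by
  cases p
  · rw [tildeRight_zero, ε_d, map_zero, TensorProduct.zero_tmul, map_zero]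
  · rfl

theorem d_neg (h : ContractingHomotopy r s t u) (x : F r s t u 0) :
    d r s t u 0 (h.map 0 x) = x - h.neg (ε r s t u x) :=
  eq_sub_of_add_eq (h.zero_eq x)

theorem d_map_succ (h : ContractingHomotopy r s t u) (n : ℕ) (x : F r s t u (n + 1)) :
    d r s t u (n + 1) (h.map (n + 1) x) = x - h.map n (d r s t u n x) :=
  eq_sub_of_add_eq (h.succ_eq n x)

/-- In positive degrees `s̃` is a contracting homotopy of `F ⊗ F`. -/
theorem dFF_tilde_succ (h : ContractingHomotopy r s t u) (n : ℕ) (z : FF r s t u (n + 1)) :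
    dFF r s t u (n + 1) (h.tilde (n + 1) z) + h.tilde n (dFF r s t u n z) = z := by
  suffices H : dFF r s t u (n + 1) ∘ₗ h.tilde (n + 1) + h.tilde n ∘ₗ dFF r s t u n =
      LinearMap.id from LinearMap.congr_fun H z
  refine FF_hom_ext fun p q hpq x y => ?_
  simp only [LinearMap.add_apply, LinearMap.comp_apply, LinearMap.id_apply]
  rw [tilde_incl, dFF_incl, map_add, map_add, dFF_incl, dLeft_succ]
  rcases p with _ | p <;> rcases q with _ | q
  · omega
  · rw [tildeRight_zero, dFF_incl, dLeft_zero, dRight_succ, dRight_succ, dLeft_zero, dRight_succ,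
      map_zero, map_smul, tilde_incl, tildeRight_zero, d_neg, d_map_succ]
    simp only [TensorProduct.sub_tmul, TensorProduct.tmul_sub, map_sub, zero_add, pow_one, pow_zero,
      one_smul, neg_smul]
    abel
  · rw [tildeRight_succ, dRight_zero, dRight_zero, dLeft_succ, tilde_incl, tildeRight_d, d_map_succ]
    simp only [TensorProduct.sub_tmul, map_sub, map_zero, add_zero]
    abel
  · rw [tildeRight_succ, dRight_succ, dRight_succ, dLeft_succ, tilde_incl, tildeRight_d, map_smul,
      tilde_incl, tildeRight_succ, d_map_succ, pow_succ (-1 : ℤ) (p + 1)]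
    simp only [TensorProduct.sub_tmul, map_sub, map_zero, add_zero, mul_neg, mul_one, neg_smul]
    abel

theorem εFF_incl (x y : F r s t u 0) :
    εFF r s t u (incl 0 0 rfl (x ⊗ₜ[ℤ] y)) = ε r s t u x * ε r s t u y := by
  have h : proj 0 0 rfl (incl 0 0 rfl (x ⊗ₜ[ℤ] y)) = x ⊗ₜ[ℤ] y :=
    DirectSum.component.lof_self ℤ _ _
  exact (congrArg (fun z => LinearMap.mul' ℤ ℤ
    (TensorProduct.map (ε r s t u) (ε r s t u) z)) h).trans (by simp)

theorem neg_eq_smul (h : ContractingHomotopy r s t u) (k : ℤ) : h.neg k = k • h.neg 1 := by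
  rw [← map_smul, smul_eq_mul, mul_one]

/-- In degree `0` the homotopy `s̃` contracts `F ⊗ F` onto the span of `s_{-1}(1) ⊗ s_{-1}(1)`. -/
theorem dFF_tilde_zero (h : ContractingHomotopy r s t u) (z : FF r s t u 0) :
    dFF r s t u 0 (h.tilde 0 z) + εFF r s t u z • incl 0 0 rfl (h.neg 1 ⊗ₜ[ℤ] h.neg 1) = z := by
  suffices H : dFF r s t u 0 ∘ₗ h.tilde 0 +
      (εFF r s t u).smulRight (incl 0 0 rfl (h.neg 1 ⊗ₜ[ℤ] h.neg 1)) =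
      LinearMap.id from LinearMap.congr_fun H z
  refine FF_hom_ext fun p q hpq x y => ?_
  obtain ⟨rfl, rfl⟩ : p = 0 ∧ q = 0 := by omega
  simp only [LinearMap.add_apply, LinearMap.comp_apply, LinearMap.id_apply,
    LinearMap.smulRight_apply]
  have hk : (ε r s t u x * ε r s t u y) • incl 0 0 rfl (h.neg 1 ⊗ₜ[ℤ] h.neg 1) =
      incl (n := 0) 0 0 rfl (h.neg (ε r s t u x) ⊗ₜ[ℤ] h.neg (ε r s t u y)) := by
    rw [neg_eq_smul h (ε r s t u x), neg_eq_smul h (ε r s t u y), TensorProduct.smul_tmul_smul,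
      map_smul]
  rw [tilde_incl, εFF_incl, map_add, dFF_incl, dLeft_succ, dRight_zero, tildeRight_zero, dFF_incl,
    dLeft_zero, dRight_succ, d_neg, d_neg, hk]
  simp only [TensorProduct.sub_tmul, TensorProduct.tmul_sub, map_sub, zero_add, add_zero, pow_zero,
    one_smul]
  abel

theorem actFF_incl (n p q : ℕ) (h : p + q = n) (g : G r s t u) (x : F r s t u p)
    (y : F r s t u q) :
    actFF r s t u n g (incl p q h (x ⊗ₜ[ℤ] y)) =
      incl p q h ((gr g • x) ⊗ₜ[ℤ] (gr g • y)) :=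
  DirectSum.lmap_lof _ _ _

theorem dFF_actFF (n : ℕ) (g : G r s t u) (z : FF r s t u (n + 1)) :
    dFF r s t u n (actFF r s t u (n + 1) g z) = actFF r s t u n g (dFF r s t u n z) := by
  suffices H : dFF r s t u n ∘ₗ actFF r s t u (n + 1) g =
      actFF r s t u n g ∘ₗ dFF r s t u n from LinearMap.congr_fun H z
  refine FF_hom_ext fun p q hpq x y => ?_
  simp only [LinearMap.comp_apply]
  rw [actFF_incl, dFF_incl, dFF_incl, map_add]
  congr 1
  · cases p
    · rw [dLeft_zero, dLeft_zero, map_zero]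
    · rw [dLeft_succ, dLeft_succ, actFF_incl, map_smul]
  · cases q
    · rw [dRight_zero, dRight_zero, map_zero]
    · rw [dRight_succ, dRight_succ, map_smul, map_smul, actFF_incl]

end TensorSquare

/-! ### Handel's diagonal -/

section Handel

variable {r s t u : ℤ}

theorem extend_smul_e (n : ℕ) (v : B n → FF r s t u n) (a : ZG r s t u) (b : B n) :
    extend n v (a • e r s t u n b) = (actFF r s t u n).asAlgebraHom a (v b) := by
  have h : a • e r s t u n b = (Finsupp.single b a : B n →₀ ZG r s t u) := by
    refine (Finsupp.smul_single _ _ _).trans ?_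
    rw [smul_eq_mul, mul_one]
  rw [h]
  exact Finsupp.liftAddHom_apply_single _ _ _

theorem extend_gr_smul (n : ℕ) (v : B n → FF r s t u n) (g : G r s t u) (b : B n) :
    extend n v (gr g • e r s t u n b) = actFF r s t u n g (v b) := by
  rw [extend_smul_e, Representation.asAlgebraHom_of]

theorem extend_equivariant (n : ℕ) (v : B n → FF r s t u n) (g : G r s t u) (x : F r s t u n) :
    extend n v (gr g • x) = actFF r s t u n g (extend n v x) := by
  induction x using F_induction with
  | h0 => simp
  | hadd a b ha hb => rw [smul_add, map_add, map_add, ha, hb, map_add]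
  | hneg a ha => rw [smul_neg, map_neg, map_neg, ha, map_neg]
  | hof g' b =>
    rw [← mul_smul, ← gr_mul, extend_gr_smul, extend_gr_smul, map_mul]
    rfl

theorem extend_e (n : ℕ) (v : B n → FF r s t u n) (b : B n) :
    extend n v (e r s t u n b) = v b := by
  have h := extend_gr_smul n v 1 b
  rwa [gr, map_one, one_smul, map_one] at h

variable (h : ContractingHomotopy r s t u)

theorem handel_equivariant (n : ℕ) (g : G r s t u) (x : F r s t u n) :
    h.handel n (gr g • x) = actFF r s t u n g (h.handel n x) := by
  cases n <;> exact extend_equivariant _ _ g x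

theorem ε_e₀ : ε r s t u (e₀ r s t u) = 1 := by
  have h := ε_gr_smul r s t u 1
  rwa [gr, map_one, one_smul] at h

theorem handel_zero_gr (g : G r s t u) : h.handel 0 (gr g • e₀ r s t u) =
    incl 0 0 rfl ((gr g • h.neg 1) ⊗ₜ[ℤ] (gr g • h.neg 1)) := by
  rw [handel_equivariant, ContractingHomotopy.handel, extend_e, ε_e₀, actFF_incl]

theorem handel_succ_e (n : ℕ) (b : B (n + 1)) : h.handel (n + 1) (e r s t u (n + 1) b) =
    h.tilde n (h.handel n (d r s t u n (e r s t u (n + 1) b))) := by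
  rw [ContractingHomotopy.handel, extend_e]

theorem ε_gr_smul' (g : G r s t u) (x : F r s t u 0) : ε r s t u (gr g • x) = ε r s t u x := by
  rw [← eq_coord_smul r s t u x, ← mul_smul, ε_smul, ε_smul, map_mul]
  simp [gr]

theorem εFF_handel (x : F r s t u 0) : εFF r s t u (h.handel 0 x) = ε r s t u x := by
  induction x using F_induction with
  | h0 => simp
  | hadd a b ha hb => rw [map_add, map_add, map_add, ha, hb]
  | hneg a ha => rw [map_neg, map_neg, map_neg, ha]
  | hof g b =>
    rw [handel_zero_gr, εFF_incl, ε_gr_smul', ε_gr_smul', h.neg_eq, ε_e₀, one_mul]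

theorem dFF_handel (hF : IsFreeResolution r s t u) (n : ℕ) (x : F r s t u (n + 1)) :
    dFF r s t u n (h.handel (n + 1) x) = h.handel n (d r s t u n x) := by
  induction n with
  | zero =>
    induction x using F_induction with
    | h0 => simp
    | hadd a b ha hb => rw [map_add, map_add, map_add, map_add, ha, hb]
    | hneg a ha => rw [map_neg, map_neg, map_neg, map_neg, ha]
    | hof g b =>
      rw [handel_equivariant, dFF_actFF, map_smul, handel_equivariant, handel_succ_e]
      have h₁ := dFF_tilde_zero h (h.handel 0 (d r s t u 0 (e r s t u 1 b)))
      rw [εFF_handel, ε_d, zero_smul, add_zero] at h₁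
      rw [h₁]
  | succ n ih =>
    induction x using F_induction with
    | h0 => simp
    | hadd a b ha hb => rw [map_add, map_add, map_add, map_add, ha, hb]
    | hneg a ha => rw [map_neg, map_neg, map_neg, map_neg, ha]
    | hof g b =>
      rw [handel_equivariant, dFF_actFF, map_smul, handel_equivariant, handel_succ_e]
      have h₁ := dFF_tilde_succ h n (h.handel (n + 1) (d r s t u (n + 1) (e r s t u (n + 2) b)))
      rw [ih, (hF.exact_succ n).apply_apply_eq_zero, map_zero, map_zero, add_zero] at h₁
      rw [h₁]

/-- Chain map and augmentation follow from the homotopy identities for `s̃`, by induction on the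
degree. -/
theorem isDiagonalApproximation (hF : IsFreeResolution r s t u) :
    IsDiagonalApproximation r s t u h.handel where
  equivariant := handel_equivariant h
  chain_map := dFF_handel h hF
  augmentation := εFF_handel h

/-! ### The values of the diagonal in low degrees -/

theorem s₀_wd_normalForm (hdet : r * u - s * t = 1 ∨ r * u - s * t = -1) (p : NormalForm) :
    s₀ r s t u (wd r s t u p.word) = foxVec r s t u p.word := by
  rw [wd, s₀_gr, normalWord_toG hdet]

theorem s₀_one (hdet : r * u - s * t = 1 ∨ r * u - s * t = -1) : s₀ r s t u 1 = 0 := by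
  have := s₀_wd_normalForm hdet ⟨[], by simp, List.isChain_nil, 0, 0⟩
  rwa [NormalForm.word, List.map_nil, List.prod_nil, zpow_zero, zpow_zero, mul_one, mul_one, wd_one,
    foxVec_one] at this

theorem s₀_wd_b₁_zpow (hdet : r * u - s * t = 1 ∨ r * u - s * t = -1) (n : ℤ) :
    s₀ r s t u (wd r s t u (wb₁ ^ n)) = foxVec r s t u (wb₁ ^ n) := by
  have := s₀_wd_normalForm hdet ⟨[], by simp, List.isChain_nil, 0, n⟩
  rwa [NormalForm.word, List.map_nil, List.prod_nil, zpow_zero, one_mul, one_mul] at this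

theorem s₀_wd_of (hdet : r * u - s * t = 1 ∨ r * u - s * t = -1) (x : Gen) :
    s₀ r s t u (wd r s t u (FreeGroup.of x)) = e r s t u 1 x := by
  have hx (hx : x = .a₁ ∨ x = .a₂) :
      s₀ r s t u (wd r s t u (FreeGroup.of x)) = e r s t u 1 x := by
    have := s₀_wd_normalForm hdet ⟨[x], by simpa using hx, List.isChain_singleton x, 0, 0⟩
    rwa [NormalForm.word, List.map_singleton, List.prod_singleton, zpow_zero, zpow_zero, mul_one,
      mul_one, foxVec_of] at this
  cases x
  · exact hx (Or.inl rfl)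
  · have := s₀_wd_b₁_zpow hdet 1
    rwa [zpow_one, foxVec_of] at this
  · exact hx (Or.inr rfl)

variable {h}

theorem handel_one_e (hdet : r * u - s * t = 1 ∨ r * u - s * t = -1) (hh : h.Extends) (x : Gen) :
    h.handel 1 (e r s t u 1 x) =
      incl 1 0 rfl (e r s t u 1 x ⊗ₜ[ℤ] (wd r s t u (FreeGroup.of x) • e₀ r s t u)) +
        incl 0 1 rfl (e₀ r s t u ⊗ₜ[ℤ] e r s t u 1 x) := by
  have h₁ : h.handel 0 (e₀ r s t u) = incl 0 0 rfl (e₀ r s t u ⊗ₜ[ℤ] e₀ r s t u) := by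
    have := handel_zero_gr h 1
    rwa [gr, map_one, one_smul, one_smul, hh.1] at this
  have h₂ : h.map 0 (e₀ r s t u) = 0 := by
    rw [← one_smul (ZG r s t u) (e₀ r s t u), hh.2, s₀_one hdet]
  rw [handel_succ_e, d_e]
  change h.tilde 0 (h.handel 0 (d₁ r s t u x)) = _
  rw [d₁, sub_smul, one_smul, map_sub, h₁, wd, handel_zero_gr, hh.1, map_sub, tilde_incl,
    tilde_incl, tildeRight_zero, tildeRight_zero, h₂, hh.2, s₀_wd_of hdet, ε_gr_smul, hh.1]
  simp

theorem deltaOneFormulas (hdet : r * u - s * t = 1 ∨ r * u - s * t = -1) (hh : h.Extends) :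
    DeltaOneFormulas (h.handel 1) where
  on_α₁ := handel_one_e hdet hh _
  on_β₁ := handel_one_e hdet hh _
  on_α₂ := handel_one_e hdet hh _

theorem s₀tensor_zero (y : F r s t u 1) : s₀tensor (0 : ZG r s t u) y = 0 := by
  simp [s₀tensor]

theorem s₀tensor_add (X X' : ZG r s t u) (y : F r s t u 1) :
    s₀tensor (X + X') y = s₀tensor X y + s₀tensor X' y := by
  rw [s₀tensor, MonoidAlgebra.coeff_add, Finsupp.sum_add_index' (by simp)
    (fun _ _ _ => add_smul _ _ _)]
  rfl

theorem s₀tensor_neg (X : ZG r s t u) (y : F r s t u 1) :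
    s₀tensor (-X) y = -s₀tensor X y := by
  rw [eq_neg_iff_add_eq_zero, ← s₀tensor_add, neg_add_cancel, s₀tensor_zero]

theorem s₀tensor_gr (g : G r s t u) (y : F r s t u 1) :
    s₀tensor (gr g) y = s₀ r s t u (gr g) ⊗ₜ[ℤ] (gr g • y) := by
  simp [s₀tensor, gr]

theorem s₀tensor_one (hdet : r * u - s * t = 1 ∨ r * u - s * t = -1) (y : F r s t u 1) :
    s₀tensor (1 : ZG r s t u) y = 0 := by
  have := s₀tensor_gr (1 : G r s t u) y
  rwa [gr, map_one, s₀_one hdet, TensorProduct.zero_tmul] at this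

theorem proj_incl_self {n p q : ℕ} (hpq : p + q = n) (z : F r s t u p ⊗[ℤ] F r s t u q) :
    proj p q hpq (incl p q hpq z) = z := DirectSum.component.lof_self ℤ _ _

theorem proj_incl_of_ne {n p q p' q' : ℕ} (hpq : p + q = n) (hpq' : p' + q' = n) (hne : p' ≠ p)
    (z : F r s t u p' ⊗[ℤ] F r s t u q') : proj p q hpq (incl p' q' hpq' z) = 0 := by
  classical
  refine (DirectSum.component.of ℤ _ _ _).trans (dif_neg fun h => hne ?_)
  exact congrArg (fun p => p.1.1) h

/-- Of the summands of `s̃ Δ₁(g x)` only `s₀(g) ⊗ g x` lies in `F₁ ⊗ F₁`. -/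
theorem proj_tilde_handel_one (hdet : r * u - s * t = 1 ∨ r * u - s * t = -1) (hh : h.Extends)
    (a : ZG r s t u) (x : Gen) :
    proj 1 1 rfl (h.tilde 1 (h.handel 1 (a • e r s t u 1 x))) = s₀tensor a (e r s t u 1 x) := by
  induction a using ZG_induction with
  | h0 => rw [zero_smul, map_zero, map_zero, map_zero, s₀tensor_zero]
  | hadd a b ha hb => rw [add_smul, map_add, map_add, map_add, ha, hb, s₀tensor_add]
  | hneg a ha => rw [neg_smul, map_neg, map_neg, map_neg, ha, s₀tensor_neg]
  | hof g =>
    rw [handel_equivariant, handel_one_e hdet hh, map_add, actFF_incl, actFF_incl, map_add,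
      tilde_incl, tilde_incl, tildeRight_succ, tildeRight_zero, hh.2, add_zero, map_add, map_add,
      proj_incl_of_ne _ _ (by simp), proj_incl_self, proj_incl_of_ne _ _ (by simp), zero_add,
      add_zero, s₀tensor_gr]

theorem proj_handel_two (hdet : r * u - s * t = 1 ∨ r * u - s * t = -1) (hh : h.Extends)
    (ρ : Rel) :
    (proj 1 1 rfl ∘ₗ h.handel 2) (e r s t u 2 ρ) =
      s₀tensor (d₂coeff r s t u ρ .a₁) (α₁ r s t u) +
        s₀tensor (d₂coeff r s t u ρ .b₁) (β₁ r s t u) +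
          s₀tensor (d₂coeff r s t u ρ .a₂) (α₂ r s t u) := by
  rw [LinearMap.comp_apply, handel_succ_e, d_e]
  change proj 1 1 rfl (h.tilde 1 (h.handel 1 (d₂ r s t u ρ))) = _
  rw [d₂]
  simp only [map_add, proj_tilde_handel_one hdet hh]

theorem deltaOneOneFormulas (hdet : r * u - s * t = 1 ∨ r * u - s * t = -1) (hh : h.Extends) :
    DeltaOneOneFormulas (proj 1 1 rfl ∘ₗ h.handel 2) where
  on_ρ₁ := by
    have hb : s₀ r s t u (wd r s t u wb₁⁻¹) = -(wd r s t u wb₁⁻¹ • β₁ r s t u) := by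
      have := s₀_wd_b₁_zpow hdet (-1)
      rwa [zpow_neg_one, foxVec_inv, foxVec_of] at this
    rw [proj_handel_two hdet hh]
    simp only [d₂coeff]
    rw [sub_eq_add_neg (1 : ZG r s t u), s₀tensor_add, s₀tensor_one hdet, s₀tensor_neg,
      s₀tensor_gr, hb, s₀tensor_add, s₀tensor_gr, s₀_wd_of hdet, s₀tensor_gr, hb, s₀tensor_zero]
    simp only [TensorProduct.neg_tmul]
    abel
  on_ρ₂ := by
    rw [proj_handel_two hdet hh]
    simp only [d₂coeff]
    rw [sub_eq_add_neg _ (1 : ZG r s t u), s₀tensor_add, s₀tensor_neg, s₀tensor_neg,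
      s₀tensor_one hdet, s₀tensor_gr, s₀_wd_of hdet]
    abel
  on_ρ₃ := by
    rw [proj_handel_two hdet hh]
    simp only [d₂coeff]
    rw [sub_eq_add_neg (1 : ZG r s t u), s₀tensor_add 1, s₀tensor_one hdet, s₀tensor_neg,
      s₀tensor_gr]
    abel

end Handel

end Sapphire

theorem mainTheorem2 (r s t u : ℤ) (hdet : r * u - s * t = 1 ∨ r * u - s * t = -1)
    (hne : r * s * t * u ≠ 0) :
    -- every element of `G` has a unique normal form, which makes `s₀` well defined
    (∀ g : Sapphire.G r s t u,
      ∃! p : Sapphire.NormalForm, Sapphire.toG r s t u p.word = g) ∧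
    -- `F` is a free resolution of `ℤ` over `ℤG`
    Sapphire.IsFreeResolution r s t u ∧
    -- `s_{-1}` and `s₀` are the beginning of a contracting homotopy of `F`
    (∃ h : Sapphire.ContractingHomotopy r s t u, h.Extends) ∧
    -- Handel's diagonal for any such contracting homotopy is a diagonal approximation,
    -- with the stated values of `Δ₁` and `Δ_{1,1}`
    ∀ h : Sapphire.ContractingHomotopy r s t u, h.Extends →
      Sapphire.IsDiagonalApproximation r s t u h.handel ∧
      Sapphire.DeltaOneFormulas (h.handel 1) ∧
      Sapphire.DeltaOneOneFormulas (Sapphire.proj 1 1 rfl ∘ₗ h.handel 2) :=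
  ⟨Sapphire.existsUnique_normalForm hdet, Sapphire.isFreeResolution hdet,
    Sapphire.exists_contractingHomotopy hdet, fun h hh =>
      ⟨Sapphire.isDiagonalApproximation h (Sapphire.isFreeResolution hdet),
        Sapphire.deltaOneFormulas hdet hh, Sapphire.deltaOneOneFormulas hdet hh⟩⟩
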